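/- Let $n\ge 3$, let $U$ be a smooth $n$-dimensional manifold with or without boundary, let $g$ be a smooth Riemannian metric on $U$, let $u$ be a smooth positive function on $U$, and let $0\le k\le n-1$. Put $g_u=u^{\frac{4}{n-2}}g$. Conventions. The Schouten tensor of a metric $h$ is $A_h=\frac{1}{n-2}\big(\mathrm{Ric}_h-\frac{1}{2(n-1)}R_h\,h\big)$; for $h=g_u$ we also write $A_{g_u}$ for the $(1,1)$-tensor obtained by raising its first index with $g_u$. For a $(1,1)$-tensor $A$, the functions $\sigma_m(A)$ are defined by $\det(\lambda I-A)=\sum_{m=0}^n(-1)^m\sigma_m(A)\lambda^{n-m}$, and the Newton tensors by $(T_m(A))^i{}_j=\frac{\partial\sigma_{m+1}}{\partial A^j{}_i}(A)$, $0\le m\le n-1$. Let $\nabla$ be the Levi-Civita connection of $g$; indices are raised and lowered with $g$. The curvature is normalized by $\nabla_i\nabla_jV^l-\nabla_j\nabla_iV^l=\mathrm{Riem}_{ij}{}^l{}_sV^s$ and $\mathrm{Ric}_{js}=\mathrm{Riem}_{ij}{}^i{}_s$; with $A=A_g$, the Weyl tensor $W$ and the Cotton tensor $C$ of $g$ are given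 by \[ \mathrm{Riem}_{ij}{}^l{}_s=-A^l{}_jg_{is}+A^l{}_ig_{js}-A_{is}\delta^l{}_j+A_{js}\delta^l{}_i+W_{ij}{}^l{}_s,\qquad C^l{}_{ji}=(n-2)\big(\nabla_iA^l{}_j-\nabla_jA^l{}_i\big). \] Then, in every local coordinate system and at every point of it, \begin{align*} \nabla_j T_k{}^j{}_r(A_{g_u}) &=-\frac{2}{n-2}\frac{\nabla_ju}{u}\Big[n\,T_k{}^j{}_r(A_{g_u})-(n-k)\sigma_k(A_{g_u})\delta^j{}_r\Big]\\ &\quad+\frac{1}{n-2}u^{-\frac{n+2}{n-2}}\sum_{q=1}^{k-1}(-1)^{k-q}\,T_q{}^j{}_l(A_{g_u})\big[-2W_{jt}{}^l{}_s\nabla^su+u\,C^l{}_{tj}\big](A_{g_u}^{k-1-q})^t{}_r, \end{align*} where the sum over $q$ is empty for $k=0$ and $k=1$. Moreover, if $k\le 1$ or if $g$ is locally conformally flat (every point has a neighbourhood on which some smooth positive multiple $\rho g$ of $g$ has vanishing Riemann curvature), then $T_k(A_{g_u})$ is divergence-free with respect to $g_u$: $\widetilde\nabla_jT_k{}^j{}_r(A_{g_u})=0$,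 where $\widetilde\nabla$ is the Levi-Civita connection of $g_u$. -/

import Mathlib

open scoped ContDiff Manifold Topology

noncomputable section

namespace ConfGeom

/-- The model vector space `ℝⁿ`. -/
abbrev Euc (n : ℕ) : Type := EuclideanSpace ℝ (Fin n)

/-! ### Algebra: the elementary symmetric functions and the Newton tensors of a matrix

A `(1,1)`-tensor `A` is represented by the matrix whose `(i, j)` entry is `Aⁱⱼ`. -/

section Algebra

variable {n : ℕ}

/-- `σ_k(A)`, for `0 ≤ k ≤ n`, defined by `det (λ I - A) = ∑_{k=0}^n (-1)^k σ_k(A) λ^(n-k)`. -/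
def sigma (k : ℕ) (A : Matrix (Fin n) (Fin n) ℝ) : ℝ :=
  (-1) ^ k * A.charpoly.coeff (n - k)

/-- The Newton tensor `T_k(A)`, for `0 ≤ k ≤ n - 1`: its `(i, j)` entry `(T_k(A))ⁱⱼ` is the
partial derivative of `σ_{k+1}` with respect to the entry `Aʲᵢ`. -/
def newton (k : ℕ) (A : Matrix (Fin n) (Fin n) ℝ) : Matrix (Fin n) (Fin n) ℝ :=
  Matrix.of fun i j => deriv (fun t : ℝ => sigma (k + 1) (A + t • Matrix.single j i 1)) 0

end Algebra

/-! ### Tensor calculus in local coordinates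

`s` is the coordinate domain (relatively open in `ℝⁿ`, or in a half-space near a boundary point;
partial derivatives are one-sided at boundary points), and `G y` is the matrix `(g_ij)` of the
components of the metric at the point `y`. -/

section Coordinates

variable {n : ℕ} (s : Set (Euc n))

/-- The partial derivative `∂_i f` at `y`. -/
def pd (i : Fin n) (f : Euc n → ℝ) (y : Euc n) : ℝ :=
  fderivWithin ℝ f s y (EuclideanSpace.single i 1)

variable (G : Euc n → Matrix (Fin n) (Fin n) ℝ)

/-- The Christoffel symbol `Γˡ_ij` of the Levi-Civita connection. -/
def christoffel (l i j : Fin n) (y : Euc n) : ℝ :=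
  (1 / 2) * ∑ m, (G y)⁻¹ l m *
    (pd s i (fun z => G z j m) y + pd s j (fun z => G z i m) y - pd s m (fun z => G z i j) y)

/-- `riem s G i j l q` is the component `Riem_{ij}{}^l{}_q` of the Riemann curvature tensor,
normalized by `∇_i ∇_j Vˡ - ∇_j ∇_i Vˡ = Riem_{ij}{}^l{}_q V^q`. -/
def riem (i j l q : Fin n) (y : Euc n) : ℝ :=
  pd s i (christoffel s G l j q) y - pd s j (christoffel s G l i q) y
    + ∑ m, (christoffel s G l i m y * christoffel s G m j q y
      - christoffel s G l j m y * christoffel s G m i q y)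

/-- The Ricci tensor `Ric_jq = Riem_{ij}{}^i{}_q`. -/
def ricci (j q : Fin n) (y : Euc n) : ℝ := ∑ i, riem s G i j i q y

/-- The scalar curvature. -/
def scalarCurv (y : Euc n) : ℝ := ∑ j, ∑ q, (G y)⁻¹ j q * ricci s G j q y

/-- The Schouten tensor `A_ij = (Ric_ij - R g_ij / (2 (n - 1))) / (n - 2)`. -/
def schouten (i j : Fin n) (y : Euc n) : ℝ :=
  (1 / ((n : ℝ) - 2)) * (ricci s G i j y - scalarCurv s G y / (2 * ((n : ℝ) - 1)) * G y i j)

/-- The `(1,1)`-Schouten tensor, as the matrix of the `Aⁱⱼ = g^im A_mj`. -/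
def schoutenMixed (y : Euc n) : Matrix (Fin n) (Fin n) ℝ :=
  Matrix.of fun i j => ∑ m, (G y)⁻¹ i m * schouten s G m j y

/-- `weyl s G i j l q` is the component `W_{ij}{}^l{}_q` of the Weyl tensor:
`Riem_{ij}{}^l{}_q = Aˡᵢ g_jq - Aˡⱼ g_iq - A_iq δˡⱼ + A_jq δˡᵢ + W_{ij}{}^l{}_q`. -/
def weyl (i j l q : Fin n) (y : Euc n) : ℝ :=
  riem s G i j l q y
    - (schoutenMixed s G y l i * G y j q - schoutenMixed s G y l j * G y i q
      - schouten s G i q y * (if l = j then 1 else 0)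
      + schouten s G j q y * (if l = i then 1 else 0))

/-- The component `∇_k A_ij` of the covariant derivative of the Schouten tensor. -/
def covSchouten (k i j : Fin n) (y : Euc n) : ℝ :=
  pd s k (schouten s G i j) y
    - ∑ m, (christoffel s G m k i y * schouten s G m j y
      + christoffel s G m k j y * schouten s G i m y)

/-- The Cotton tensor `C_mij = (n - 2) (∇_j A_mi - ∇_i A_mj)`, that is
`C_mij = ∇_j Ric_mi - ∇_i Ric_mj + (∇_i R g_mj - ∇_j R g_mi) / (2 (n - 1))`. -/
def cotton (m i j : Fin n) (y : Euc n) : ℝ :=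
  ((n : ℝ) - 2) * (covSchouten s G j m i y - covSchouten s G i m j y)

/-- The Cotton tensor with its first index raised, `Cˡ_ij = g^lm C_mij`. -/
def cottonUp (l i j : Fin n) (y : Euc n) : ℝ := ∑ m, (G y)⁻¹ l m * cotton s G m i j y

/-- The component `∇^i f = g^im ∂_m f` of the gradient of a function. -/
def gradUp (f : Euc n → ℝ) (i : Fin n) (y : Euc n) : ℝ := ∑ m, (G y)⁻¹ i m * pd s m f y

/-- The divergence `∇_j Tʲ_r` of a `(1,1)`-tensor `T`. -/
def divMixed (T : Euc n → Matrix (Fin n) (Fin n) ℝ) (r : Fin n) (y : Euc n) : ℝ :=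
  ∑ j, (pd s j (fun z => T z j r) y
    + ∑ m, (christoffel s G j j m y * T y m r - christoffel s G m j r y * T y j m))

end Coordinates

/-! ### Metrics on manifolds -/

section Manifold

variable {n : ℕ} {H : Type*} [TopologicalSpace H] (I : ModelWithCorners ℝ (Euc n) H)
  {M : Type*} [TopologicalSpace M] [ChartedSpace H M]

/-- The coordinate vector field `∂_i` of the chart `e`, at the point with coordinates `y`. -/
def coordVec (e : OpenPartialHomeomorph M H) (i : Fin n) (y : Euc n) :
    TangentSpace I ((e.extend I).symm y) :=
  mfderivWithin 𝓘(ℝ, Euc n) I (e.extend I).symm (e.extend I).target y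
    (EuclideanSpace.single i 1 : Euc n)

variable {I}

/-- The matrix `(h(∂_i, ∂_j))` of a field `h` of bilinear forms on the tangent spaces, in the
chart `e`. -/
def components (h : (x : M) → TangentSpace I x →L[ℝ] TangentSpace I x →L[ℝ] ℝ)
    (e : OpenPartialHomeomorph M H) (y : Euc n) : Matrix (Fin n) (Fin n) ℝ :=
  Matrix.of fun i j => h ((e.extend I).symm y) (coordVec I e i y) (coordVec I e j y)

/-- The field of bilinear forms `ρ h`. -/
def rescale (ρ : M → ℝ) (h : (x : M) → TangentSpace I x →L[ℝ] TangentSpace I x →L[ℝ] ℝ) :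
    (x : M) → TangentSpace I x →L[ℝ] TangentSpace I x →L[ℝ] ℝ :=
  fun x => ρ x • h x

/-- The conformal metric `g_u = u^(4/(n-2)) g`. -/
def conformal (u : M → ℝ) (h : (x : M) → TangentSpace I x →L[ℝ] TangentSpace I x →L[ℝ] ℝ) :
    (x : M) → TangentSpace I x →L[ℝ] TangentSpace I x →L[ℝ] ℝ :=
  rescale (fun x => u x ^ (4 / ((n : ℝ) - 2))) h

/-- The metric `h` is locally conformally flat: every point has an open neighbourhood `V` with a
smooth positive function `ρ` on `V` such that `ρ h` is flat in `V`, i.e. its Riemann curvature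
tensor vanishes in `V`. -/
def LocallyConformallyFlat
    (h : (x : M) → TangentSpace I x →L[ℝ] TangentSpace I x →L[ℝ] ℝ) : Prop :=
  ∀ p : M, ∃ V : Set M, IsOpen V ∧ p ∈ V ∧ ∃ ρ : M → ℝ,
    ContMDiffOn I 𝓘(ℝ) ∞ ρ V ∧ (∀ x ∈ V, 0 < ρ x) ∧
    ∀ e ∈ IsManifold.maximalAtlas I ∞ M, ∀ x ∈ e.source ∩ V, ∀ i j l q : Fin n,
      riem (e.extend I).target (components (rescale ρ h) e) i j l q (e.extend I x) = 0

end Manifold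

end ConfGeom

end

/-! Write `g_u = w g` with `w = u^(4/(n-2))`, and let `φ = dw/(2w) = (2/(n-2)) du/u`. For a
`g`-symmetric `(1,1)`-tensor `T`, comparing the two connections gives `∇̃_j Tʲ_r = ∇_j Tʲ_r + n φ_j
Tʲ_r - φ_r tr T` (`div_scale`). With `T = T_k(A_{g_u})` and `tr T_k = (n-k) σ_k`, this produces the
first line of the formula, and it remains to compute the divergence of `T_k(A_{g_u})` for `g_u`
itself.

For any metric, differentiate `T_{k+1} = σ_{k+1} - T_k A`. Since `dσ_{k+1} = tr(T_k ∇A)`, only the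
antisymmetrization `∇_t Aˡ_j - ∇_j Aˡ_t` and `-(div T_k) A` survive (`div_newtonR_succ`), and
iteration gives a sum over `q < k`. The term `q = 0` is a trace, which vanishes by the contracted
second Bianchi identity (`trace_cov_schMixed`). Hence the sum starts at `1` and is empty for `k ≤
1`.

Under a conformal change `A_{g_u} = A_g - S(φ)` (`sch_scale`), and the Ricci identity for the
Hessian shows that the antisymmetrized derivative changes exactly by a Weyl term contracted with `φ`
(`cov_sch_scale`). This expresses it through `W` and `C` of `g`. If `ρ g` is flat, the same formula
with `ρ g` as base metric makes every term vanish.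

The tensor calculus takes place in a commutative `ℝ`-algebra with commuting derivations
(`MetricAlgebra`). Smooth functions on a coordinate domain form such an algebra, including near
boundary points, and evaluation at a point (`Represents`) recovers the coordinate expressions. -/

namespace ConfGeom

open Polynomial Matrix

/-! ### Jacobi's formula for derivations, and derivations of polynomial rings -/

section NewtonAlgebra

variable {ι K R : Type*} [Fintype ι] [DecidableEq ι] [CommRing K] [CommRing R] [Algebra K R]

/-- A derivation of a product over a finite set. -/
theorem derivation_prod {α : Type*} [DecidableEq α] (d : Derivation K R R) (s : Finset α)
    (f : α → R) :
    d (∏ a ∈ s, f a) = ∑ a ∈ s, (∏ b ∈ s.erase a, f b) * d (f a) := by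
  induction s using Finset.induction_on with
  | empty => simp
  | insert a s ha ih =>
    rw [Finset.prod_insert ha, Derivation.leibniz, ih, Finset.sum_insert ha,
      Finset.erase_insert ha, smul_eq_mul, smul_eq_mul, Finset.mul_sum, add_comm]
    congr 1
    refine Finset.sum_congr rfl fun b hb => ?_
    have hab : a ≠ b := fun h => ha (h ▸ hb)
    rw [Finset.erase_insert_of_ne hab, Finset.prod_insert (fun h => ha (Finset.mem_of_mem_erase h))]
    ring

/-- Jacobi's formula for a derivation. -/
theorem derivation_det (d : Derivation K R R) (M : Matrix ι ι R) :
    d M.det = (M.adjugate * M.map d).trace := by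
  have h1 : d M.det = ∑ i, (M.updateCol i (fun j => d (M j i))).det := by
    simp only [det_apply, map_sum]
    rw [Finset.sum_comm]
    refine Finset.sum_congr rfl fun σ _ => ?_
    rw [Derivation.map_smul_of_tower, derivation_prod, Finset.smul_sum]
    refine Finset.sum_congr rfl fun i _ => ?_
    congr 1
    rw [← Finset.prod_erase_mul _ _ (Finset.mem_univ i)]
    congr 1
    · refine Finset.prod_congr rfl fun j hj => ?_
      rw [updateCol_ne (Finset.ne_of_mem_erase hj)]
    · rw [updateCol_self]
  rw [h1, trace]
  refine Finset.sum_congr rfl fun i _ => ?_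
  rw [diag_apply, mul_apply, ← cramer_apply, cramer_eq_adjugate_mulVec, mulVec, dotProduct]
  rfl

/-- The coefficientwise extension of a derivation to polynomials. -/
noncomputable def polyDerivation (d : Derivation K R R) : Derivation K R[X] R[X] :=
  (PolynomialModule.equivPolynomialSelf (R := R)).toLinearMap.compDer d.mapCoeffs

theorem polyDerivation_coeff (d : Derivation K R R) (p : R[X]) (i : ℕ) :
    (polyDerivation d p).coeff i = d (p.coeff i) := rfl

theorem polyDerivation_X (d : Derivation K R R) : polyDerivation d (X : R[X]) = 0 := by
  ext i
  rw [polyDerivation_coeff, coeff_X]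
  split_ifs <;> simp

theorem polyDerivation_C (d : Derivation K R R) (a : R) :
    polyDerivation d (C a) = C (d a) := by
  ext i
  rw [polyDerivation_coeff, coeff_C, coeff_C]
  split_ifs <;> simp

end NewtonAlgebra

/-! ### Elementary symmetric functions and Newton tensors over a commutative ring -/

section SigmaNewton

variable {n : ℕ} {K R : Type*} [CommRing K] [CommRing R] [Algebra K R]

/-- The elementary symmetric function `σ_k` of a matrix over a commutative ring. -/
noncomputable def sigmaR (k : ℕ) (A : Matrix (Fin n) (Fin n) R) : R :=
  (-1) ^ k * A.charpoly.coeff (n - k)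

/-- The Newton tensors of a matrix over a commutative ring, by the recursion
`T_{k+1} = σ_{k+1} - T_k A`. -/
noncomputable def newtonR (A : Matrix (Fin n) (Fin n) R) : ℕ → Matrix (Fin n) (Fin n) R
  | 0 => 1
  | k + 1 => sigmaR (k + 1) A • 1 - newtonR A k * A

theorem charmatrix_eq_smul_one_sub (A : Matrix (Fin n) (Fin n) R) :
    A.charmatrix = (X : R[X]) • (1 : Matrix (Fin n) (Fin n) R[X]) - A.map C := by
  rw [charmatrix, smul_one_eq_diagonal]
  rfl

theorem sigmaR_zero (A : Matrix (Fin n) (Fin n) R) : sigmaR 0 A = 1 := by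
  nontriviality R
  have h := A.charpoly_monic
  rw [Monic, leadingCoeff, A.charpoly_natDegree_eq_dim, Fintype.card_fin] at h
  simp [sigmaR, h]

theorem sigmaR_map {S : Type*} [CommRing S] (f : R →+* S) (k : ℕ) (A : Matrix (Fin n) (Fin n) R) :
    sigmaR k (A.map f) = f (sigmaR k A) := by
  simp [sigmaR, charpoly_map]

theorem newtonR_map {S : Type*} [CommRing S] (f : R →+* S) (k : ℕ)
    (A : Matrix (Fin n) (Fin n) R) : newtonR (A.map f) k = (newtonR A k).map f := by
  induction k with
  | zero => simp [newtonR]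
  | succ k ih =>
    rw [newtonR, newtonR, ih, sigmaR_map]
    ext i j
    simp [Matrix.mul_apply, Matrix.one_apply, apply_ite f]

theorem newtonR_commute (A : Matrix (Fin n) (Fin n) R) (k : ℕ) :
    newtonR A k * A = A * newtonR A k := by
  induction k with
  | zero => simp [newtonR]
  | succ k ih => simp only [newtonR, sub_mul, mul_sub, ih, smul_mul_assoc, mul_smul_comm, one_mul,
      mul_one, mul_assoc]

/-- The coefficients of the adjugate of `X - A` are the Newton tensors up to sign. -/
theorem adjugate_charmatrix_coeff (A : Matrix (Fin n) (Fin n) R) (k : ℕ) (hk : k < n)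
    (i j : Fin n) :
    (A.charmatrix.adjugate i j).coeff (n - 1 - k) = (-1) ^ k * newtonR A k i j := by
  set B : ℕ → Matrix (Fin n) (Fin n) R := fun m => Matrix.of fun a b =>
    (A.charmatrix.adjugate a b).coeff m with hB
  -- Coefficient of `X^(m+1)` in `adj(X - A) (X - A) = χ_A`.
  have key : ∀ m, B m = A.charpoly.coeff (m + 1) • 1 + B (m + 1) * A := by
    intro m
    have h : A.charmatrix.adjugate * ((X : R[X]) • (1 : Matrix (Fin n) (Fin n) R[X]) - A.map C) =
        A.charpoly • 1 := by
      rw [← charmatrix_eq_smul_one_sub]; exact adjugate_mul _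
    rw [mul_sub, mul_smul_comm, mul_one] at h
    ext a b
    have h2 := congrArg (fun M : Matrix (Fin n) (Fin n) R[X] => (M a b).coeff (m + 1)) h
    simp only [Matrix.sub_apply, Matrix.smul_apply, smul_eq_mul, mul_apply, map_apply, coeff_sub,
      finsetSum_coeff, coeff_X_mul, coeff_mul_C, sub_eq_iff_eq_add] at h2
    simp only [hB, of_apply, Matrix.add_apply, Matrix.smul_apply, mul_apply, smul_eq_mul]
    rw [h2]
    congr 1
    by_cases hab : a = b
    · subst hab; simp
    · simp [hab]
  -- Above degree `n` the characteristic polynomial contributes nothing to `key`, so one nonzero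
  -- coefficient would force all higher ones to be nonzero, which is impossible for polynomials.
  have hdeg : ∀ m, n ≤ m → B m = 0 := by
    intro m hm
    by_contra hne
    have step : ∀ p, B (m + p) ≠ 0 := by
      intro p
      induction p with
      | zero => exact hne
      | succ p ih =>
        intro h0
        apply ih
        rw [key, show m + p + 1 = m + (p + 1) by ring, h0, zero_mul, add_zero]
        nontriviality R
        rw [coeff_eq_zero_of_natDegree_lt, zero_smul]
        rw [A.charpoly_natDegree_eq_dim, Fintype.card_fin]; omega
    have hbound : ∃ N, ∀ a b, (A.charmatrix.adjugate a b).natDegree < N := by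
      refine ⟨(∑ a, ∑ b, (A.charmatrix.adjugate a b).natDegree) + 1, fun a b => ?_⟩
      refine Nat.lt_succ_of_le ?_
      refine le_trans ?_ (Finset.single_le_sum (f := fun a => ∑ b,
        (A.charmatrix.adjugate a b).natDegree) (fun _ _ => Nat.zero_le _) (Finset.mem_univ a))
      exact Finset.single_le_sum (f := fun b => (A.charmatrix.adjugate a b).natDegree)
        (fun _ _ => Nat.zero_le _) (Finset.mem_univ b)
    obtain ⟨N, hN⟩ := hbound
    apply step N
    ext a b
    simp only [hB, of_apply, Matrix.zero_apply]
    exact coeff_eq_zero_of_natDegree_lt (lt_of_lt_of_le (hN a b) (by omega))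
  have main : ∀ k, k < n → B (n - 1 - k) = (-1 : R) ^ k • newtonR A k := by
    intro k
    induction k with
    | zero =>
      intro h
      rw [key, show n - 1 - 0 + 1 = n by omega, hdeg n le_rfl]
      have h0 := sigmaR_zero A
      simp only [sigmaR, pow_zero, one_mul, tsub_zero] at h0
      simp [newtonR, h0]
    | succ k ih =>
      intro h
      rw [key, show n - 1 - (k + 1) + 1 = n - 1 - k by omega, ih (by omega), newtonR, sigmaR,
        show n - (k + 1) = n - 1 - k by omega, smul_sub, smul_smul, ← mul_assoc, ← mul_pow]
      simp [pow_succ]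
  have := congrFun (congrFun (main k hk) i) j
  simpa [hB] using this

/-- The differential of `σ_{k+1}` is given by the Newton tensor `T_k`. -/
theorem derivation_sigmaR (d : Derivation K R R) (A : Matrix (Fin n) (Fin n) R) (k : ℕ)
    (hk : k < n) : d (sigmaR (k + 1) A) = (newtonR A k * A.map d).trace := by
  have h := derivation_det (polyDerivation d) A.charmatrix
  -- The coefficientwise derivation kills `X`, so only `-dA` is left of `X - A`.
  have hM : A.charmatrix.map (polyDerivation d) = -(A.map d).map C := by
    ext1 a b
    rw [charmatrix_eq_smul_one_sub]
    simp only [map_apply, Matrix.sub_apply, map_sub, Matrix.smul_apply, smul_eq_mul,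
      polyDerivation_C, Matrix.neg_apply]
    by_cases hab : a = b
    · subst hab; simp [polyDerivation_X]
    · simp [hab]
  have hc := congrArg (fun p : R[X] => p.coeff (n - 1 - k)) h
  simp only [hM, polyDerivation_coeff] at hc
  have hsign : (sigmaR (k + 1) A) = -((-1 : ℤ) ^ k • A.charpoly.coeff (n - 1 - k)) := by
    rw [sigmaR, show n - (k + 1) = n - 1 - k by omega, pow_succ]
    simp [zsmul_eq_mul]
  rw [hsign, map_neg, map_zsmul, charpoly, hc, mul_neg, trace_neg, coeff_neg, smul_neg, neg_neg]
  simp only [trace, diag_apply, mul_apply, map_apply, finsetSum_coeff, coeff_mul_C]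
  rw [Finset.smul_sum]
  refine Finset.sum_congr rfl fun i _ => ?_
  rw [Finset.smul_sum]
  refine Finset.sum_congr rfl fun j _ => ?_
  rw [adjugate_charmatrix_coeff A k hk, zsmul_eq_mul]
  push_cast
  rw [← mul_assoc, ← mul_assoc, ← mul_pow]
  simp

/-- The trace of the Newton tensor. -/
theorem trace_newtonR (A : Matrix (Fin n) (Fin n) R) (k : ℕ) (hk : k < n) :
    (newtonR A k).trace = ((n : R) - k) * sigmaR k A := by
  -- Jacobi's formula for `d/dX` gives `χ_A' = tr adj(X - A)`, because `X - A` has derivative `1`;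
  -- compare coefficients.
  have h := derivation_det (derivative' (R := R)) A.charmatrix
  have hM : A.charmatrix.map (derivative' (R := R)) = 1 := by
    ext1 a b
    rw [charmatrix_eq_smul_one_sub]
    simp only [map_apply, Matrix.sub_apply, derivative'_apply, map_sub, Matrix.smul_apply,
      smul_eq_mul, derivative_C, sub_zero]
    by_cases hab : a = b
    · subst hab; simp
    · simp [hab]
  rw [hM, mul_one, derivative'_apply] at h
  have hc := congrArg (fun p : R[X] => p.coeff (n - 1 - k)) h
  simp only [trace, diag_apply, finsetSum_coeff, adjugate_charmatrix_coeff A k hk] at hc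
  rw [← Finset.mul_sum, coeff_derivative, show n - 1 - k + 1 = n - k by omega] at hc
  have h1 : (((-1 : R)) ^ k * (-1) ^ k) = 1 := by rw [← mul_pow]; simp
  have h2 : ((n - 1 - k : ℕ) : R) + 1 = (n : R) - k := by
    rw [← Nat.cast_sub hk.le, show n - k = (n - 1 - k) + 1 by omega]; push_cast; ring
  rw [h2] at hc
  simp only [trace, diag_apply, sigmaR, charpoly]
  linear_combination (-(-1 : R) ^ k) * hc - (∑ i, newtonR A k i i) * h1

theorem sigma_eq_sigmaR (k : ℕ) (A : Matrix (Fin n) (Fin n) ℝ) : sigma k A = sigmaR k A := rfl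

/-- Along the line `A + t E_ji` the function `σ_{k+1}` is a polynomial in `t`, so the analytic
derivative is the formal one in `ℝ[X]`. There `derivation_sigmaR` applies, and `X = 0` is
substituted at the end. -/
theorem newton_eq_newtonR (k : ℕ) (hk : k < n) (A : Matrix (Fin n) (Fin n) ℝ) :
    newton k A = newtonR A k := by
  ext i j
  set M : Matrix (Fin n) (Fin n) ℝ[X] := A.map C + (X : ℝ[X]) • (single j i 1) with hMdef
  have hM : ∀ t : ℝ, M.map (evalRingHom t) = A + t • single j i 1 := by
    intro t
    ext a b
    simp [hMdef, single_apply]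
    split_ifs <;> simp
  have h1 : (fun t : ℝ => sigma (k + 1) (A + t • single j i 1)) =
      fun t => (sigmaR (k + 1) M).eval t := by
    funext t
    rw [sigma_eq_sigmaR, ← hM, sigmaR_map]
    rfl
  have h2 := derivation_sigmaR (derivative' (R := ℝ)) M k hk
  have h3 : M.map (derivative' (R := ℝ)) = single j i 1 := by
    ext1 a b
    simp only [hMdef, map_apply, Matrix.add_apply, Matrix.smul_apply, derivative'_apply,
      single_apply, smul_eq_mul]
    split_ifs <;> simp
  rw [newton, of_apply, h1, Polynomial.deriv, ← derivative'_apply, h2, h3]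
  have h4 : (newtonR M k * single j i 1).trace = newtonR M k i j := by
    simp [trace_mul_single]
  rw [h4]
  have h5 : (newtonR M k).map (evalRingHom 0) = newtonR A k := by
    rw [← newtonR_map, hM]; simp
  rw [← h5]
  rfl

end SigmaNewton

end ConfGeom

/-! ### Algebraic Levi-Civita connection, curvature and their symmetries -/

namespace ConfGeom

open Matrix

section MapDerivation

variable {ι κ μ K R : Type*} [CommRing K] [CommRing R] [Algebra K R]

theorem map_derivation_mul [Fintype κ] (d : Derivation K R R) (A : Matrix ι κ R)
    (B : Matrix κ μ R) : (A * B).map d = A.map d * B + A * B.map d := by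
  ext i j
  simp only [map_apply, mul_apply, map_sum, Derivation.leibniz, Matrix.add_apply,
    Finset.sum_add_distrib, smul_eq_mul]
  rw [add_comm]
  congr 1
  exact Finset.sum_congr rfl fun _ _ => mul_comm _ _

theorem map_derivation_add (d : Derivation K R R) (A B : Matrix ι κ R) :
    (A + B).map d = A.map d + B.map d := by ext; simp

theorem map_derivation_sub (d : Derivation K R R) (A B : Matrix ι κ R) :
    (A - B).map d = A.map d - B.map d := by ext; simp

theorem map_derivation_smul (d : Derivation K R R) (a : R) (A : Matrix ι κ R) :
    (a • A).map d = d a • A + a • A.map d := by ext; simp; ring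

theorem map_derivation_one [DecidableEq ι] (d : Derivation K R R) :
    (1 : Matrix ι ι R).map d = 0 := by
  ext i j
  by_cases h : i = j
  · subst h; simp
  · simp [h]

end MapDerivation

/-- Commuting derivations `D i` of a ring (thought of as the partial derivatives of functions in a
coordinate domain) and a symmetric invertible matrix `G` (the components of a metric), with
inverse `Gi`. -/
structure MetricAlgebra (n : ℕ) (R : Type*) [CommRing R] [Algebra ℝ R] where
  D : Fin n → Derivation ℝ R R
  D_comm : ∀ i j f, D i (D j f) = D j (D i f)
  G : Matrix (Fin n) (Fin n) R
  Gi : Matrix (Fin n) (Fin n) R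
  symm : Gᵀ = G
  mul_inv : G * Gi = 1

namespace MetricAlgebra

variable {n : ℕ} {R : Type*} [CommRing R] [Algebra ℝ R] (M : MetricAlgebra n R)

theorem inv_mul : M.Gi * M.G = 1 := mul_eq_one_comm.mp M.mul_inv

theorem Gi_symm : M.Giᵀ = M.Gi := by
  have h := congrArg transpose M.mul_inv
  rw [transpose_mul, transpose_one, M.symm] at h
  calc M.Giᵀ = M.Giᵀ * (M.G * M.Gi) := by rw [M.mul_inv, mul_one]
    _ = M.Gi := by rw [← mul_assoc, h, one_mul]

theorem G_apply_comm (i j : Fin n) : M.G i j = M.G j i := congrFun (congrFun M.symm j) i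

theorem Gi_apply_comm (i j : Fin n) : M.Gi i j = M.Gi j i := congrFun (congrFun M.Gi_symm j) i

theorem map_D_comm (i j : Fin n) (A : Matrix (Fin n) (Fin n) R) :
    (A.map (M.D i)).map (M.D j) = (A.map (M.D j)).map (M.D i) := by
  ext a b; simp only [map_apply]; exact M.D_comm _ _ _

/-- The Christoffel symbols: `Gam i l j = Γˡ_ij`. -/
noncomputable def Gam (i : Fin n) : Matrix (Fin n) (Fin n) R :=
  of fun l j => algebraMap ℝ R (1 / 2) * ∑ m, M.Gi l m *
    (M.D i (M.G j m) + M.D j (M.G i m) - M.D m (M.G i j))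

/-- The curvature: `Rm i j l q = Riem_{ij}{}^l{}_q`. -/
noncomputable def Rm (i j : Fin n) : Matrix (Fin n) (Fin n) R :=
  (M.Gam j).map (M.D i) - (M.Gam i).map (M.D j) + (M.Gam i * M.Gam j - M.Gam j * M.Gam i)

/-- The Ricci tensor. -/
noncomputable def ric : Matrix (Fin n) (Fin n) R := of fun j q => ∑ i, M.Rm i j i q

/-- The scalar curvature. -/
noncomputable def scal : R := ∑ j, ∑ q, M.Gi j q * M.ric j q

/-- The Schouten tensor. -/
noncomputable def sch : Matrix (Fin n) (Fin n) R := of fun i j =>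
  algebraMap ℝ R (1 / ((n : ℝ) - 2)) *
    (M.ric i j - M.scal * algebraMap ℝ R (1 / (2 * ((n : ℝ) - 1))) * M.G i j)

/-- The `(1,1)`-Schouten tensor. -/
noncomputable def schMixed : Matrix (Fin n) (Fin n) R := M.Gi * M.sch

/-- The Weyl tensor: `wey i j l q = W_{ij}{}^l{}_q`. -/
noncomputable def wey (i j : Fin n) : Matrix (Fin n) (Fin n) R := of fun l q =>
  M.Rm i j l q - (M.schMixed l i * M.G j q - M.schMixed l j * M.G i q
    - M.sch i q * (1 : Matrix (Fin n) (Fin n) R) l j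
    + M.sch j q * (1 : Matrix (Fin n) (Fin n) R) l i)

/-- The covariant derivative `∇_k B_ij` of a `(0,2)`-tensor. -/
noncomputable def cov (k : Fin n) (B : Matrix (Fin n) (Fin n) R) : Matrix (Fin n) (Fin n) R :=
  B.map (M.D k) - (M.Gam k)ᵀ * B - B * M.Gam k

/-- The covariant derivative `∇_k Tⁱⱼ` of a `(1,1)`-tensor. -/
noncomputable def covMixed (k : Fin n) (T : Matrix (Fin n) (Fin n) R) : Matrix (Fin n) (Fin n) R :=
  T.map (M.D k) + M.Gam k * T - T * M.Gam k

/-- The divergence `∇_j Tʲ_r` of a `(1,1)`-tensor. -/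
noncomputable def div (T : Matrix (Fin n) (Fin n) R) (r : Fin n) : R := ∑ j, M.covMixed j T j r

theorem Gam_comm (i l j : Fin n) : M.Gam i l j = M.Gam j l i := by
  simp only [Gam, of_apply]
  congr 1
  refine Finset.sum_congr rfl fun m _ => ?_
  rw [M.G_apply_comm i j]; ring

theorem half_mul_two : algebraMap ℝ R (1 / 2) * 2 = 1 := by
  rw [← map_ofNat (algebraMap ℝ R) 2, ← map_mul]; norm_num

theorem eq_zero_of_eq_neg {x : R} (h : x = -x) : x = 0 := by
  linear_combination (-x) * half_mul_two (R := R) + algebraMap ℝ R (1 / 2) * h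

theorem G_mul_Gam (i p j : Fin n) : (M.G * M.Gam i) p j =
    algebraMap ℝ R (1 / 2) * (M.D i (M.G j p) + M.D j (M.G i p) - M.D p (M.G i j)) := by
  have h : M.Gam i = algebraMap ℝ R (1 / 2) • (M.Gi * of fun m j =>
      (M.D i (M.G j m) + M.D j (M.G i m) - M.D m (M.G i j))) := by
    ext l j; simp [Gam, mul_apply]
  rw [h, mul_smul_comm, ← mul_assoc, M.mul_inv, one_mul]
  simp

/-- Metric compatibility in matrix form: in the sum of the two lowered Christoffel symbols all
derivatives cancel except `∂_k G`. -/
theorem map_G (k : Fin n) : M.G.map (M.D k) = (M.Gam k)ᵀ * M.G + M.G * M.Gam k := by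
  have h : (M.Gam k)ᵀ * M.G = (M.G * M.Gam k)ᵀ := by rw [transpose_mul, M.symm]
  ext i j
  rw [h, Matrix.add_apply, transpose_apply, G_mul_Gam, G_mul_Gam, map_apply, M.G_apply_comm j i]
  linear_combination (-M.D k (M.G i j)) * half_mul_two (R := R)

theorem cov_G (k : Fin n) : M.cov k M.G = 0 := by
  rw [cov, M.map_G]; noncomm_ring

theorem map_Gi (k : Fin n) : M.Gi.map (M.D k) = -(M.Gam k * M.Gi) - M.Gi * (M.Gam k)ᵀ := by
  have h := congrArg (fun A => A.map (M.D k)) M.mul_inv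
  simp only [map_derivation_mul, map_derivation_one] at h
  have h2 : M.Gi.map (M.D k) = -(M.Gi * M.G.map (M.D k) * M.Gi) := by
    have h3 := congrArg (fun A => M.Gi * A) h
    simp only [mul_add, ← mul_assoc, M.inv_mul, one_mul, mul_zero] at h3
    exact eq_neg_of_add_eq_zero_right h3
  rw [h2, M.map_G, mul_add, add_mul, ← mul_assoc, ← mul_assoc, mul_assoc _ M.G, M.mul_inv,
    M.inv_mul, one_mul, mul_one]
  abel

/-- The inverse metric is parallel, so raising an index commutes with `∇`. -/
theorem covMixed_inv_mul (k : Fin n) (B : Matrix (Fin n) (Fin n) R) :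
    M.covMixed k (M.Gi * B) = M.Gi * M.cov k B := by
  rw [covMixed, cov, map_derivation_mul, M.map_Gi]
  noncomm_ring

theorem Rm_antisymm (i j : Fin n) : M.Rm i j = -M.Rm j i := by
  rw [Rm, Rm]; abel

/-- Substituting `map_G` twice into `∂_i ∂_j G = ∂_j ∂_i G` leaves exactly the curvature acting on
`G`. -/
theorem transpose_Rm_mul (i j : Fin n) : (M.Rm i j)ᵀ * M.G = -(M.G * M.Rm i j) := by
  have h := M.map_D_comm j i M.G
  rw [M.map_G, M.map_G] at h
  simp only [map_derivation_add, map_derivation_mul, M.map_G, transpose_map] at h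
  rw [← sub_eq_zero] at h
  rw [eq_neg_iff_add_eq_zero, ← h]
  simp only [Rm, transpose_add, transpose_sub, transpose_mul]
  noncomm_ring

theorem Rm_mul_inv_apply (i j a b : Fin n) :
    (M.Rm i j * M.Gi) a b = -(M.Rm i j * M.Gi) b a := by
  have h : (M.Rm i j * M.Gi)ᵀ = -(M.Rm i j * M.Gi) := by
    have h2 := congrArg (fun A => M.Gi * A * M.Gi) (M.transpose_Rm_mul i j)
    simp only [mul_assoc, M.mul_inv, mul_one, mul_neg, neg_mul] at h2
    rw [← mul_assoc, M.inv_mul, one_mul] at h2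
    rw [transpose_mul, M.Gi_symm, h2]
  have h3 := congrFun (congrFun h b) a
  simpa using h3

theorem trace_Rm (i j : Fin n) : (M.Rm i j).trace = 0 := by
  apply eq_zero_of_eq_neg
  have h := congrArg (fun A => (M.Gi * A).trace) (M.transpose_Rm_mul i j)
  simp only [mul_neg, ← mul_assoc, M.inv_mul, one_mul, trace_neg] at h
  rw [← h, mul_assoc, trace_mul_comm, mul_assoc, M.mul_inv, mul_one, trace_transpose]

theorem first_bianchi (i j k l : Fin n) :
    M.Rm i j l k + M.Rm j k l i + M.Rm k i l j = 0 := by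
  have hP : ∀ a b c, (M.Gam a * M.Gam b) l c = (M.Gam a * M.Gam c) l b := by
    intro a b c
    simp only [mul_apply]
    exact Finset.sum_congr rfl fun m _ => by rw [M.Gam_comm b m c]
  simp only [Rm, Matrix.add_apply, Matrix.sub_apply, map_apply]
  rw [M.Gam_comm j l k, M.Gam_comm i l k, M.Gam_comm j l i, hP i j k, hP j i k, hP k i j]
  ring

/-- Contraction of the first Bianchi identity; the middle term is the trace of the curvature
endomorphism, which is zero. -/
theorem ric_symm (j q : Fin n) : M.ric j q = M.ric q j := by
  have h : ∑ i, (M.Rm i j i q + M.Rm j q i i + M.Rm q i i j) = 0 :=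
    Finset.sum_eq_zero fun i _ => M.first_bianchi i j q i
  simp only [Finset.sum_add_distrib] at h
  have h2 := M.trace_Rm j q
  simp only [trace, diag_apply] at h2
  have h3 : ∑ i, M.Rm q i i j = -M.ric q j := by
    rw [ric, of_apply, ← Finset.sum_neg_distrib]
    exact Finset.sum_congr rfl fun i _ => by rw [M.Rm_antisymm q i, Matrix.neg_apply]
  rw [h2, h3] at h
  simp only [ric, of_apply] at h ⊢
  linear_combination h

theorem ric_transpose : M.ricᵀ = M.ric := by ext i j; exact M.ric_symm j i

theorem sch_symm (i j : Fin n) : M.sch i j = M.sch j i := by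
  simp only [sch, of_apply]
  rw [M.ric_symm, M.G_apply_comm]

theorem sch_transpose : M.schᵀ = M.sch := by ext i j; exact M.sch_symm j i

/-- The Bianchi identity `dF + [Γ, F] = 0` for a matrix-valued connection form. Only the
endomorphism indices are differentiated covariantly here. -/
theorem second_bianchi (i j k : Fin n) :
    M.covMixed k (M.Rm i j) + M.covMixed i (M.Rm j k) + M.covMixed j (M.Rm k i) = 0 := by
  simp only [covMixed, Rm, map_derivation_add, map_derivation_sub, map_derivation_mul]
  rw [M.map_D_comm i k, M.map_D_comm j k, M.map_D_comm j i]
  noncomm_ring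

end MetricAlgebra

end ConfGeom

/-! ### Contracted Bianchi identity and the derivative of the Schouten tensor -/

namespace ConfGeom

open Matrix

namespace MetricAlgebra

variable {n : ℕ} {R : Type*} [CommRing R] [Algebra ℝ R] (M : MetricAlgebra n R)

/-- The covariant derivative of the curvature tensor. -/
noncomputable def covRm (k i j : Fin n) : Matrix (Fin n) (Fin n) R :=
  M.covMixed k (M.Rm i j) - ∑ m, M.Gam k m i • M.Rm m j - ∑ m, M.Gam k m j • M.Rm i m

theorem covRm_antisymm (k i j : Fin n) : M.covRm k i j = -M.covRm k j i := by
  have h1 : ∀ x y, ∑ m, M.Gam k m x • M.Rm m y = -∑ m, M.Gam k m x • M.Rm y m := by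
    intro x y
    rw [← Finset.sum_neg_distrib]
    exact Finset.sum_congr rfl fun m _ => by rw [M.Rm_antisymm m y, smul_neg]
  have h2 : M.covMixed k (M.Rm i j) = -M.covMixed k (M.Rm j i) := by
    rw [M.Rm_antisymm i j, covMixed, covMixed]
    have : (-M.Rm j i).map (M.D k) = -(M.Rm j i).map (M.D k) := by ext; simp
    rw [this]; noncomm_ring
  rw [covRm, covRm, h1 i j, h1 j i, h2]
  abel

/-- The Christoffel corrections on the two form indices cancel in pairs in the cyclic sum because
the connection is torsion-free. -/
theorem second_bianchi_cov (i j k : Fin n) :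
    M.covRm k i j + M.covRm i j k + M.covRm j k i = 0 := by
  have h : ∀ x y z, ∑ m, M.Gam x m y • M.Rm m z = -∑ m, M.Gam y m x • M.Rm z m := by
    intro x y z
    rw [← Finset.sum_neg_distrib]
    exact Finset.sum_congr rfl fun m _ => by rw [M.Rm_antisymm m z, M.Gam_comm x m y, smul_neg]
  rw [covRm, covRm, covRm, h k i j, h i j k, h j k i, ← M.second_bianchi i j k]
  abel

theorem covMixed_mul_inv_antisymm (k : Fin n) (F : Matrix (Fin n) (Fin n) R)
    (hF : (F * M.Gi)ᵀ = -(F * M.Gi)) :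
    (M.covMixed k F * M.Gi)ᵀ = -(M.covMixed k F * M.Gi) := by
  have h : M.covMixed k F * M.Gi =
      (F * M.Gi).map (M.D k) + M.Gam k * (F * M.Gi) + (F * M.Gi) * (M.Gam k)ᵀ := by
    rw [map_derivation_mul, M.map_Gi, covMixed]
    noncomm_ring
  have h2 : ((F * M.Gi).map (M.D k))ᵀ = -((F * M.Gi).map (M.D k)) := by
    rw [← transpose_map, hF]; ext; simp
  rw [h]
  generalize F * M.Gi = X at *
  rw [transpose_add, transpose_add, transpose_mul, transpose_mul, h2, hF, transpose_transpose]
  noncomm_ring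

theorem Rm_mul_inv_transpose (i j : Fin n) : (M.Rm i j * M.Gi)ᵀ = -(M.Rm i j * M.Gi) := by
  ext a b
  rw [transpose_apply, M.Rm_mul_inv_apply, Matrix.neg_apply]

theorem covRm_mul_inv_transpose (k i j : Fin n) :
    (M.covRm k i j * M.Gi)ᵀ = -(M.covRm k i j * M.Gi) := by
  simp only [covRm, sub_mul, Finset.sum_mul, smul_mul_assoc, transpose_sub, transpose_sum,
    transpose_smul, M.Rm_mul_inv_transpose,
    M.covMixed_mul_inv_antisymm k _ (M.Rm_mul_inv_transpose i j), smul_neg,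
    Finset.sum_neg_distrib]
  abel

theorem sum_covRm (k j q : Fin n) : ∑ i, M.covRm k i j i q = M.cov k M.ric j q := by
  simp only [covRm, covMixed, cov, Matrix.sub_apply, Matrix.add_apply, mul_apply, map_apply,
    Matrix.sum_apply, Matrix.smul_apply, smul_eq_mul, transpose_apply, ric, of_apply, map_sum,
    Finset.sum_sub_distrib, Finset.sum_add_distrib, Finset.mul_sum, Finset.sum_mul]
  rw [Finset.sum_comm (f := fun i m => M.Gam k i m * M.Rm i j m q),
    Finset.sum_comm (f := fun i m => M.Rm i j i m * M.Gam k m q),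
    Finset.sum_comm (f := fun i m => M.Gam k m j * M.Rm i m i q)]
  have : ∑ y, ∑ x, M.Gam k x y * M.Rm x j y q = ∑ x, ∑ m, M.Gam k m x * M.Rm m j x q := rfl
  rw [this]
  ring

theorem derivation_trace (k : Fin n) (T : Matrix (Fin n) (Fin n) R) :
    M.D k T.trace = (M.covMixed k T).trace := by
  rw [covMixed, trace_sub, trace_add, trace_mul_comm T]
  simp [trace]

theorem scal_eq_trace : M.scal = (M.Gi * M.ric).trace := by
  simp only [scal, trace, diag_apply, mul_apply]
  exact Finset.sum_congr rfl fun j _ => Finset.sum_congr rfl fun q _ => by rw [M.ric_symm]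

theorem contracted_bianchi (k : Fin n) :
    M.D k M.scal = 2 * ∑ i, ∑ q, M.cov i M.ric k q * M.Gi q i := by
  have h : ∑ j, ∑ q, ∑ i, ((M.covRm k i j + M.covRm i j k + M.covRm j k i) i q * M.Gi q j) = 0 :=
    Finset.sum_eq_zero fun j _ => Finset.sum_eq_zero fun q _ => Finset.sum_eq_zero fun i _ => by
      rw [M.second_bianchi_cov]; simp
  simp only [Matrix.add_apply, add_mul, Finset.sum_add_distrib] at h
  have h1 : ∑ j, ∑ q, ∑ i, M.covRm k i j i q * M.Gi q j = M.D k M.scal := by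
    simp only [← Finset.sum_mul, M.sum_covRm]
    rw [M.scal_eq_trace, M.derivation_trace, M.covMixed_inv_mul, trace_mul_comm]
    simp only [trace, diag_apply, mul_apply]
  have h3 : ∑ j, ∑ q, ∑ i, M.covRm j k i i q * M.Gi q j =
      -∑ i, ∑ q, M.cov i M.ric k q * M.Gi q i := by
    rw [← Finset.sum_neg_distrib]
    refine Finset.sum_congr rfl fun j _ => ?_
    rw [← Finset.sum_neg_distrib]
    refine Finset.sum_congr rfl fun q _ => ?_
    rw [← M.sum_covRm, Finset.sum_mul, ← Finset.sum_neg_distrib]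
    refine Finset.sum_congr rfl fun i _ => ?_
    rw [M.covRm_antisymm j k i, Matrix.neg_apply, neg_mul]
  have h2 : ∑ j, ∑ q, ∑ i, M.covRm i j k i q * M.Gi q j =
      -∑ i, ∑ q, M.cov i M.ric k q * M.Gi q i := by
    have ha : ∀ i j, ∑ q, M.covRm i j k i q * M.Gi q j =
        -∑ q, M.covRm i j k j q * M.Gi q i := by
      intro i j
      have := congrFun (congrFun (M.covRm_mul_inv_transpose i j k) j) i
      simpa only [transpose_apply, Matrix.neg_apply, mul_apply] using this
    calc ∑ j, ∑ q, ∑ i, M.covRm i j k i q * M.Gi q j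
        = ∑ j, ∑ i, ∑ q, M.covRm i j k i q * M.Gi q j :=
          Finset.sum_congr rfl fun j _ => Finset.sum_comm
      _ = ∑ j, ∑ i, -∑ q, M.covRm i j k j q * M.Gi q i := by simp only [ha]
      _ = ∑ i, ∑ q, ∑ j, -(M.covRm i j k j q * M.Gi q i) := by
          rw [Finset.sum_comm]
          refine Finset.sum_congr rfl fun i _ => ?_
          simp only [← Finset.sum_neg_distrib]
          exact Finset.sum_comm
      _ = _ := by
          simp only [Finset.sum_neg_distrib, ← Finset.sum_mul, M.sum_covRm]
  rw [h1, h2, h3] at h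
  linear_combination h

theorem cov_sub (k : Fin n) (A B : Matrix (Fin n) (Fin n) R) :
    M.cov k (A - B) = M.cov k A - M.cov k B := by
  rw [cov, cov, cov, map_derivation_sub]; noncomm_ring

theorem cov_add (k : Fin n) (A B : Matrix (Fin n) (Fin n) R) :
    M.cov k (A + B) = M.cov k A + M.cov k B := by
  rw [cov, cov, cov, map_derivation_add]; noncomm_ring

theorem cov_smul (k : Fin n) (a : R) (A : Matrix (Fin n) (Fin n) R) :
    M.cov k (a • A) = M.D k a • A + a • M.cov k A := by
  rw [cov, cov, map_derivation_smul, mul_smul_comm, smul_mul_assoc, smul_sub, smul_sub]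
  abel

theorem cov_symm (k : Fin n) (B : Matrix (Fin n) (Fin n) R) (hB : Bᵀ = B) :
    (M.cov k B)ᵀ = M.cov k B := by
  rw [cov, transpose_sub, transpose_sub, transpose_mul, transpose_mul, ← transpose_map, hB,
    transpose_transpose]
  abel

theorem sch_eq : M.sch = algebraMap ℝ R (1 / ((n : ℝ) - 2)) •
    (M.ric - (M.scal * algebraMap ℝ R (1 / (2 * ((n : ℝ) - 1)))) • M.G) := by
  ext i j; simp [sch]

theorem cov_sch (k : Fin n) : M.cov k M.sch = algebraMap ℝ R (1 / ((n : ℝ) - 2)) •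
    (M.cov k M.ric -
      (M.D k M.scal * algebraMap ℝ R (1 / (2 * ((n : ℝ) - 1)))) • M.G) := by
  rw [sch_eq, cov_smul, cov_sub, cov_smul, cov_G]
  simp [mul_comm]

theorem algebraMap_half_inv (hn : 3 ≤ n) :
    algebraMap ℝ R (1 / (2 * ((n : ℝ) - 1))) * (2 * ((n : R) - 1)) = 1 := by
  have h : (2 : R) * ((n : R) - 1) = algebraMap ℝ R (2 * ((n : ℝ) - 1)) := by
    simp [map_ofNat (algebraMap ℝ R) 2]
  have hn' : (3 : ℝ) ≤ n := by exact_mod_cast hn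
  rw [h, ← map_mul, one_div_mul_cancel (by nlinarith), map_one]

theorem algebraMap_sub_two_inv (hn : 3 ≤ n) :
    algebraMap ℝ R (1 / ((n : ℝ) - 2)) * ((n : R) - 2) = 1 := by
  have h : ((n : R) - 2) = algebraMap ℝ R ((n : ℝ) - 2) := by
    simp [map_ofNat (algebraMap ℝ R) 2]
  have hn' : (3 : ℝ) ≤ n := by exact_mod_cast hn
  rw [h, ← map_mul, one_div_mul_cancel (by linarith), map_one]

/-- The antisymmetrized covariant derivative of the `(1,1)`-Schouten tensor is trace-free. -/
theorem trace_cov_schMixed (hn : 3 ≤ n) (t : Fin n) :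
    ∑ j, (M.covMixed t M.schMixed j j - M.covMixed j M.schMixed j t) = 0 := by
  set a := algebraMap ℝ R (1 / ((n : ℝ) - 2))
  set b := algebraMap ℝ R (1 / (2 * ((n : ℝ) - 1)))
  have hb : b * (2 * ((n : R) - 1)) = 1 := algebraMap_half_inv hn
  have h1 : ∑ j, M.covMixed t M.schMixed j j =
      a * (M.D t M.scal - M.D t M.scal * b * n) := by
    rw [schMixed, M.covMixed_inv_mul, cov_sch]
    simp only [mul_smul_comm, Matrix.mul_sub, M.inv_mul, Matrix.smul_apply, Matrix.sub_apply, smul_eq_mul,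
      ← Finset.mul_sum, Finset.sum_sub_distrib]
    rw [M.scal_eq_trace, M.derivation_trace, M.covMixed_inv_mul]
    simp [trace, mul_sub, mul_assoc, a, b]
  have h2 : ∑ j, M.covMixed j M.schMixed j t =
      a * (∑ i, ∑ q, M.cov i M.ric t q * M.Gi q i - M.D t M.scal * b) := by
    simp only [schMixed, M.covMixed_inv_mul, cov_sch]
    simp only [mul_smul_comm, Matrix.mul_sub, M.inv_mul, Matrix.smul_apply, Matrix.sub_apply, smul_eq_mul,
      Finset.sum_sub_distrib, ← Finset.mul_sum]
    congr 2
    · refine Finset.sum_congr rfl fun i _ => ?_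
      rw [mul_apply]
      refine Finset.sum_congr rfl fun q _ => ?_
      rw [M.Gi_apply_comm i q, mul_comm]
      congr 1
      exact congrFun (congrFun (M.cov_symm i _ M.ric_transpose) t) q
    · simp only [Matrix.one_apply, mul_ite, mul_one, mul_zero, Finset.sum_ite_eq',
        Finset.mem_univ, if_true, b]
  rw [Finset.sum_sub_distrib, h1, h2]
  -- Since `div Ric = dR/2`, the difference of the two contractions is `a (1/2 - (n-1) b) dR`, which
  -- vanishes for `b = 1/(2(n-1))`.
  have h3 := M.contracted_bianchi t
  linear_combination (-(a * M.D t M.scal * algebraMap ℝ R (1 / 2))) * hb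
    + a * algebraMap ℝ R (1 / 2) * h3 + (a * (∑ i, ∑ q, M.cov i M.ric t q * M.Gi q i)
      - a * M.D t M.scal + a * M.D t M.scal * b * (n - 1)) * half_mul_two (R := R)

end MetricAlgebra

end ConfGeom

/-! ### Conformal change of connection, curvature and Schouten tensor -/

namespace ConfGeom

open Matrix

namespace MetricAlgebra

variable {n : ℕ} {R : Type*} [CommRing R] [Algebra ℝ R] (M : MetricAlgebra n R)

/-- The conformal metric `w G`. -/
def scale (w wi : R) (hw : w * wi = 1) : MetricAlgebra n R where
  D := M.D
  D_comm := M.D_comm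
  G := w • M.G
  Gi := wi • M.Gi
  symm := by rw [transpose_smul, M.symm]
  mul_inv := by rw [smul_mul_smul_comm, M.mul_inv, hw, one_smul]

variable (φ : Fin n → R)

/-- The Hessian of a function with differential `φ`. -/
noncomputable def hess : Matrix (Fin n) (Fin n) R :=
  of fun i q => M.D i (φ q) - ∑ m, φ m * M.Gam i m q

/-- The squared norm of `φ`. -/
def normSq : R := φ ⬝ᵥ (M.Gi *ᵥ φ)

/-- The change `A_g - A_{g̃}` of the Schouten tensor under a conformal change of metric with
logarithmic differential `φ`. -/
noncomputable def schDiff : Matrix (Fin n) (Fin n) R :=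
  M.hess φ - vecMulVec φ φ + (algebraMap ℝ R (1 / 2) * M.normSq φ) • M.G

/-- `G j φᵀ - φ (G j)ᵀ`. -/
def wedgeRow (j : Fin n) : Matrix (Fin n) (Fin n) R :=
  vecMulVec (M.G j) φ - vecMulVec φ (M.G j)

variable {φ} {w wi : R} (hw : w * wi = 1) (hφ : ∀ i, M.D i w = 2 * w * φ i)

section
include hw hφ

/-- Formally `φ = d(log w)/2`; closedness comes from commuting the derivatives of `w` and cancelling
the unit `2w`. -/
theorem closed_of_log (i j : Fin n) : M.D i (φ j) = M.D j (φ i) := by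
  have h := M.D_comm i j w
  rw [hφ, hφ] at h
  simp only [Derivation.leibniz, hφ, smul_eq_mul] at h
  have h2 : ∀ k, M.D k (2 : R) = 0 := fun k => by
    exact_mod_cast (M.D k).map_natCast 2
  rw [h2, h2] at h
  linear_combination (wi * algebraMap ℝ R (1 / 2)) * h
    - (M.D i (φ j) - M.D j (φ i)) * hw
    - (M.D i (φ j) - M.D j (φ i)) * w * wi * half_mul_two (R := R)

theorem hess_symm (i j : Fin n) : M.hess φ i j = M.hess φ j i := by
  simp only [hess, of_apply]
  rw [M.closed_of_log hw hφ i j]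
  congr 1
  exact Finset.sum_congr rfl fun m _ => by rw [M.Gam_comm]

theorem hess_transpose : (M.hess φ)ᵀ = M.hess φ := by
  ext i j; exact M.hess_symm hw hφ j i

theorem schDiff_transpose : (M.schDiff φ)ᵀ = M.schDiff φ := by
  simp only [schDiff, transpose_add, transpose_sub, transpose_smul, M.symm,
    M.hess_transpose hw hφ, transpose_vecMulVec]

/-- The difference of the connections is split into a scalar part and a part antisymmetric for the
metric. The scalar part commutes with all matrices, so it drops out of commutators, and its exterior
derivative is zero. -/
theorem Gam_scale (i : Fin n) :
    (M.scale w wi hw).Gam i = M.Gam i + (φ i • 1 + M.Gi * M.wedgeRow φ i) := by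
  have h1 : (M.scale w wi hw).Gam i = wi • (M.Gi * (w • (M.G * (M.Gam i + (φ i • 1 +
      M.Gi * M.wedgeRow φ i))))) := by
    rw [mul_add, mul_add, ← mul_assoc, M.mul_inv, one_mul]
    ext l j
    change algebraMap ℝ R (1 / 2) * ∑ m, (wi • M.Gi) l m * (M.D i ((w • M.G) j m)
      + M.D j ((w • M.G) i m) - M.D m ((w • M.G) i j)) = _
    simp only [Matrix.smul_apply, smul_eq_mul, mul_apply (M := M.Gi), Finset.mul_sum]
    refine Finset.sum_congr rfl fun m _ => ?_
    have h2 := M.G_mul_Gam i m j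
    simp only [Matrix.add_apply, h2, wedgeRow, Matrix.sub_apply, vecMulVec_apply,
      Matrix.smul_apply, smul_eq_mul, mul_one, Derivation.leibniz, hφ, mul_smul_comm]
    rw [M.G_apply_comm i m, M.G_apply_comm j m]
    linear_combination (wi * M.Gi l m * w * (φ i * M.G m j + M.G m i * φ j - φ m * M.G i j)) *
      half_mul_two (R := R)
  rw [h1, mul_smul_comm, smul_smul, mul_comm wi, hw, one_smul, ← mul_assoc, M.inv_mul, one_mul]

end

theorem cov_vecMulVec (k : Fin n) (a b : Fin n → R) (p q : Fin n) :
    M.cov k (vecMulVec a b) p q =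
      (M.D k (a p) - ∑ m, a m * M.Gam k m p) * b q
        + a p * (M.D k (b q) - ∑ m, b m * M.Gam k m q) := by
  simp only [cov, Matrix.sub_apply, map_apply, vecMulVec_apply, mul_apply, transpose_apply,
    Derivation.leibniz, smul_eq_mul, sub_mul, mul_sub, Finset.sum_mul, Finset.mul_sum]
  have h1 : ∑ x, M.Gam k x p * (a x * b q) = ∑ x, a x * M.Gam k x p * b q :=
    Finset.sum_congr rfl fun _ _ => by ring
  have h2 : ∑ x, a p * b x * M.Gam k x q = ∑ x, a p * (b x * M.Gam k x q) :=
    Finset.sum_congr rfl fun _ _ => by ring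
  rw [h1, h2]; ring

theorem covariant_row (i j q : Fin n) :
    M.D i (M.G j q) - ∑ m, M.G j m * M.Gam i m q = ((M.Gam i)ᵀ * M.G) j q := by
  have h := congrFun (congrFun (M.map_G i) j) q
  simp only [map_apply, Matrix.add_apply] at h
  rw [h, mul_apply (M := M.G)]; ring

theorem transpose_Gam_mul_comm (i j q : Fin n) :
    ((M.Gam i)ᵀ * M.G) j q = ((M.Gam j)ᵀ * M.G) i q := by
  simp only [mul_apply, transpose_apply]
  exact Finset.sum_congr rfl fun m _ => by rw [M.Gam_comm]

theorem cov_wedgeRow_sub (i j p q : Fin n) :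
    (M.cov i (M.wedgeRow φ j) - M.cov j (M.wedgeRow φ i)) p q =
      M.G j p * M.hess φ i q - M.hess φ i p * M.G j q
        - M.G i p * M.hess φ j q + M.hess φ j p * M.G i q := by
  simp only [wedgeRow, cov_sub, Matrix.sub_apply, cov_vecMulVec, covariant_row, hess, of_apply]
  rw [M.transpose_Gam_mul_comm i j p, M.transpose_Gam_mul_comm i j q]
  ring

theorem G_row_dotProduct (i : Fin n) (a : Fin n → R) : M.G i ⬝ᵥ (M.Gi *ᵥ a) = a i := by
  have : M.G i ⬝ᵥ (M.Gi *ᵥ a) = (M.G *ᵥ (M.Gi *ᵥ a)) i := rfl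
  rw [this, mulVec_mulVec, M.mul_inv, one_mulVec]

theorem Gi_mulVec_G_row (j : Fin n) : M.Gi *ᵥ M.G j = Pi.single j 1 := by
  have h : M.G j = M.G *ᵥ Pi.single j 1 := by
    ext i; simp [M.G_apply_comm j i]
  rw [h, mulVec_mulVec, M.inv_mul, one_mulVec]

theorem wedgeRow_mul (i j p q : Fin n) :
    (M.wedgeRow φ i * M.Gi * M.wedgeRow φ j) p q =
      φ j * M.G i p * φ q - M.normSq φ * M.G i p * M.G j q - M.G i j * φ p * φ q
        + φ i * φ p * M.G j q := by
  have h : ∀ a b c d : Fin n → R, vecMulVec a b * M.Gi * vecMulVec c d =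
      (b ⬝ᵥ (M.Gi *ᵥ c)) • vecMulVec a d := by
    intro a b c d
    rw [vecMulVec_mul, vecMulVec_mul_vecMulVec, dotProduct_mulVec, vecMulVec_smul]
  simp only [wedgeRow, sub_mul, mul_sub, h, G_row_dotProduct, Gi_mulVec_G_row,
    Matrix.sub_apply, Matrix.smul_apply, vecMulVec_apply, smul_eq_mul, dotProduct_single, mul_one]
  rw [← normSq]
  ring

section
include hw hφ

theorem Rm_scale (i j : Fin n) :
    (M.scale w wi hw).Rm i j = M.Rm i j + M.Gi * (of fun p q =>
      M.G j p * M.schDiff φ i q - M.schDiff φ i p * M.G j q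
        - M.G i p * M.schDiff φ j q + M.schDiff φ j p * M.G i q) := by
  -- Curvature of a perturbed connection: `F(Γ + a) = F(Γ) + d_Γ a + a ∧ a`, where the scalar part
  -- of `a` does not contribute since `φ` is closed.
  have h1 : (M.scale w wi hw).Rm i j = M.Rm i j
      + (M.Gi * (M.cov i (M.wedgeRow φ j) - M.cov j (M.wedgeRow φ i)))
      + M.Gi * (M.wedgeRow φ i * M.Gi * M.wedgeRow φ j - M.wedgeRow φ j * M.Gi * M.wedgeRow φ i) := by
    rw [Matrix.mul_sub, ← M.covMixed_inv_mul, ← M.covMixed_inv_mul]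
    simp only [Rm, M.Gam_scale hw hφ, covMixed, map_derivation_add, map_derivation_smul,
      map_derivation_one]
    have hD : (M.scale w wi hw).D = M.D := rfl
    rw [hD, M.closed_of_log hw hφ i j]
    simp only [add_mul, mul_add, smul_mul_assoc, mul_smul_comm, one_mul, mul_one, smul_zero,
      add_zero, smul_add, smul_smul, mul_comm (φ j) (φ i)]
    noncomm_ring
  rw [h1, add_assoc, ← mul_add]
  congr 2
  ext p q
  rw [Matrix.add_apply, cov_wedgeRow_sub, Matrix.sub_apply, wedgeRow_mul, wedgeRow_mul]
  simp only [schDiff, of_apply, Matrix.add_apply, Matrix.sub_apply, vecMulVec_apply,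
    Matrix.smul_apply, smul_eq_mul]
  rw [M.G_apply_comm i j]
  linear_combination (-M.normSq φ * (M.G j p * M.G i q - M.G i p * M.G j q))
      * half_mul_two (R := R)

theorem ric_scale : (M.scale w wi hw).ric = M.ric - ((n : R) - 2) • M.schDiff φ
    - (M.Gi * M.schDiff φ).trace • M.G := by
  ext j q
  have hS : ∀ a b, M.schDiff φ a b = M.schDiff φ b a := fun a b =>
    congrFun (congrFun (M.schDiff_transpose hw hφ) b) a
  have h : ∀ i, (M.scale w wi hw).Rm i j i q = M.Rm i j i q
      + ((1 : Matrix (Fin n) (Fin n) R) i j * M.schDiff φ i q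
        - (M.Gi * M.schDiff φ) i i * M.G j q - M.schDiff φ j q
        + (M.Gi * M.schDiff φ) i j * M.G i q) := by
    intro i
    rw [M.Rm_scale hw hφ, Matrix.add_apply]
    congr 1
    have e1 : (1 : Matrix (Fin n) (Fin n) R) i j = ∑ m, M.Gi i m * M.G j m := by
      rw [← M.inv_mul, mul_apply]
      exact Finset.sum_congr rfl fun m _ => by rw [M.G_apply_comm m j]
    have e2 : (1 : R) = ∑ m, M.Gi i m * M.G i m := by
      have := congrFun (congrFun M.inv_mul i) i
      rw [mul_apply, one_apply_eq] at this
      rw [← this]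
      exact Finset.sum_congr rfl fun m _ => by rw [M.G_apply_comm m i]
    rw [e1]
    conv_rhs => rw [← one_mul (M.schDiff φ j q), e2]
    simp only [mul_apply, of_apply, Finset.sum_mul, ← Finset.sum_sub_distrib,
      ← Finset.sum_add_distrib]
    refine Finset.sum_congr rfl fun m _ => ?_
    rw [hS m i, hS m j]; ring
  have hlast : ∑ i, (M.Gi * M.schDiff φ) i j * M.G i q = M.schDiff φ j q := by
    have : ∑ i, (M.Gi * M.schDiff φ) i j * M.G i q = (M.G * (M.Gi * M.schDiff φ)) q j := by
      rw [mul_apply]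
      exact Finset.sum_congr rfl fun m _ => by rw [M.G_apply_comm m q, mul_comm]
    rw [this, ← mul_assoc, M.mul_inv, one_mul, hS]
  rw [ric, of_apply]
  simp only [h, Finset.sum_add_distrib, Finset.sum_sub_distrib, hlast, ← Finset.sum_mul]
  simp only [Matrix.sub_apply, Matrix.smul_apply, smul_eq_mul, ric, of_apply, trace, diag_apply,
    Finset.sum_const, Finset.card_univ, Fintype.card_fin, nsmul_eq_mul, Matrix.one_apply,
    ite_mul, one_mul, zero_mul, Finset.sum_ite_eq', Finset.mem_univ, if_true]
  ring

theorem scal_scale : (M.scale w wi hw).scal =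
    wi * (M.scal - (2 * ((n : R) - 1)) * (M.Gi * M.schDiff φ).trace) := by
  rw [scal_eq_trace, M.ric_scale hw hφ, scal_eq_trace]
  simp only [scale, smul_mul_assoc, mul_sub, mul_smul_comm, M.inv_mul, trace_smul, trace_sub,
    trace_one, Fintype.card_fin, smul_eq_mul]
  ring

/-- The normalization of the Schouten tensor makes the trace terms in the changes of `Ric` and of `R
g` cancel. -/
theorem sch_scale (hn : 3 ≤ n) : (M.scale w wi hw).sch = M.sch - M.schDiff φ := by
  have ha := algebraMap_sub_two_inv (R := R) hn
  have hb := algebraMap_half_inv (R := R) hn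
  rw [sch_eq, sch_eq, M.scal_scale hw hφ, M.ric_scale hw hφ]
  ext i j
  simp only [scale, Matrix.smul_apply, Matrix.sub_apply, smul_eq_mul]
  set a := algebraMap ℝ R (1 / ((n : ℝ) - 2))
  set b := algebraMap ℝ R (1 / (2 * ((n : ℝ) - 1)))
  set τ := (M.Gi * M.schDiff φ).trace
  linear_combination (-M.schDiff φ i j) * ha + a * τ * w * wi * M.G i j * hb
    - (a * b * M.scal * M.G i j - a * τ * M.G i j) * hw

end

end MetricAlgebra

end ConfGeom

/-! ### Conformal change of the antisymmetrized derivative of the Schouten tensor -/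

namespace ConfGeom

open Matrix

namespace MetricAlgebra

variable {n : ℕ} {R : Type*} [CommRing R] [Algebra ℝ R] (M : MetricAlgebra n R)
  {φ : Fin n → R} {w wi : R} (hw : w * wi = 1) (hφ : ∀ i, M.D i w = 2 * w * φ i)

theorem G_row_vecMul (k : Fin n) (B : Matrix (Fin n) (Fin n) R) :
    M.G k ᵥ* (M.Gi * B) = B k := by
  have h : M.G k ᵥ* (M.Gi * B) = (M.G * (M.Gi * B)) k := by
    funext j; simp [vecMul, mul_apply, dotProduct]
  rw [h, ← mul_assoc, M.mul_inv, one_mul]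

theorem derivation_normSq (k : Fin n) (hH : (M.hess φ)ᵀ = M.hess φ) :
    M.D k (M.normSq φ) = 2 * (φ ᵥ* (M.Gi * M.hess φ)) k := by
  have h0 : ∀ a b : Fin n → R, (M.Gi * vecMulVec a b).trace = b ⬝ᵥ (M.Gi *ᵥ a) := by
    intro a b
    rw [mul_vecMulVec, trace_vecMulVec, dotProduct_comm]
  have h1 : M.normSq φ = (M.Gi * vecMulVec φ φ).trace := by rw [h0, normSq]
  have h2 : M.cov k (vecMulVec φ φ) =
      vecMulVec (M.hess φ k) φ + vecMulVec φ (M.hess φ k) := by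
    ext p q
    rw [cov_vecMulVec]
    simp [hess, vecMulVec_apply]
  have h3 : (φ ᵥ* (M.Gi * M.hess φ)) k = φ ⬝ᵥ (M.Gi *ᵥ M.hess φ k) := by
    rw [← vecMul_vecMul, dotProduct_mulVec]
    have : M.hess φ k = fun i => M.hess φ i k := by
      funext i; exact congrFun (congrFun hH i) k
    rw [this]; rfl
  have h4 : M.hess φ k ⬝ᵥ (M.Gi *ᵥ φ) = φ ⬝ᵥ (M.Gi *ᵥ M.hess φ k) := by
    rw [dotProduct_mulVec, dotProduct_comm, ← mulVec_transpose, M.Gi_symm]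
  rw [h1, M.derivation_trace, M.covMixed_inv_mul, h2, mul_add, trace_add, h0, h0, h3, h4]
  ring

/-- The Ricci identity for the Hessian. -/
theorem cov_hess_sub (k j i : Fin n) (hH : (M.hess φ)ᵀ = M.hess φ) :
    M.cov k (M.hess φ) i j - M.cov j (M.hess φ) i k = -(φ ᵥ* M.Rm k j) i := by
  -- The covector `φ` is stored as a matrix with all rows equal, and `cv` differentiates the column
  -- index only. Commutators are then matrix identities, and the omitted Christoffel term is
  -- symmetric in `k` and `j`.
  let cv : Fin n → Matrix (Fin n) (Fin n) R → Matrix (Fin n) (Fin n) R := fun k B =>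
    B.map (M.D k) - B * M.Gam k
  let Φ : Matrix (Fin n) (Fin n) R := of fun _ q => φ q
  have h1 : ∀ j a q, cv j Φ a q = M.hess φ j q := by
    intro j a q
    simp [cv, Φ, hess, mul_apply]
  have h2 : cv k (cv j Φ) - cv j (cv k Φ) = -(Φ * M.Rm k j) := by
    simp only [cv, map_derivation_sub, map_derivation_mul, Rm]
    rw [M.map_D_comm j k]
    noncomm_ring
  have h3 : ∀ k j, M.cov k (M.hess φ) i j =
      cv k (cv j Φ) i i - ∑ m, M.hess φ i m * M.Gam k m j := by
    intro k j
    have e : ∀ a b, M.hess φ a b = M.hess φ b a := fun a b => congrFun (congrFun hH b) a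
    have e2 : cv k (cv j Φ) i i = M.D k (cv j Φ i i) - ∑ m, cv j Φ i m * M.Gam k m i := by
      simp [cv, mul_apply]
    rw [e2]
    simp only [h1, cov, Matrix.sub_apply, map_apply, mul_apply, transpose_apply]
    rw [e i j]
    congr 2
    exact Finset.sum_congr rfl fun m _ => by rw [e m j, mul_comm]
  have h4 := congrFun (congrFun h2 i) i
  rw [Matrix.sub_apply] at h4
  have h5 : (-(Φ * M.Rm k j)) i i = -(φ ᵥ* M.Rm k j) i := by
    simp [Φ, mul_apply, vecMul, dotProduct]
  rw [h5] at h4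
  rw [h3, h3, ← h4]
  have h6 : ∑ m, M.hess φ i m * M.Gam k m j = ∑ m, M.hess φ i m * M.Gam j m k :=
    Finset.sum_congr rfl fun m _ => by rw [M.Gam_comm]
  rw [h6]; ring

section
include hw hφ

theorem cov_scale (k i j : Fin n) (B : Matrix (Fin n) (Fin n) R) (hB : Bᵀ = B) :
    (M.scale w wi hw).cov k B i j = M.cov k B i j - 2 * φ k * B i j
      + M.G k i * (φ ᵥ* (M.Gi * B)) j - φ i * B k j - B i k * φ j
      + (φ ᵥ* (M.Gi * B)) i * M.G k j := by
  have h1 : (M.wedgeRow φ k)ᵀ = -M.wedgeRow φ k := by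
    simp only [wedgeRow, transpose_sub, transpose_vecMulVec]; abel
  have h2 : (M.scale w wi hw).cov k B = M.cov k B - (2 * φ k) • B
      + M.wedgeRow φ k * (M.Gi * B) - B * M.Gi * M.wedgeRow φ k := by
    rw [cov, M.Gam_scale hw hφ, cov]
    have hD : (M.scale w wi hw).D = M.D := rfl
    rw [hD, transpose_add, transpose_add, transpose_mul, h1, M.Gi_symm, transpose_smul,
      transpose_one, two_mul, add_smul]
    simp only [add_mul, mul_add, smul_mul_assoc, mul_smul_comm, one_mul, mul_one]
    noncomm_ring
  have h3 : ∀ a, (B * M.Gi) *ᵥ a = a ᵥ* (M.Gi * B) := by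
    intro a
    rw [← vecMul_transpose, transpose_mul, hB, M.Gi_symm]
  rw [h2]
  simp only [wedgeRow, sub_mul, mul_sub, vecMulVec_mul, mul_vecMulVec, Matrix.sub_apply,
    Matrix.add_apply, Matrix.smul_apply, vecMulVec_apply, smul_eq_mul, G_row_vecMul, h3]
  have h4 : B k i = B i k := congrFun (congrFun hB i) k
  rw [h4]; ring

/-- The conformal transformation of the antisymmetrized covariant derivative of the Schouten
tensor. -/
theorem cov_sch_scale (hn : 3 ≤ n) (k i j : Fin n) :
    (M.scale w wi hw).cov k (M.scale w wi hw).sch i j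
      - (M.scale w wi hw).cov j (M.scale w wi hw).sch i k =
    M.cov k M.sch i j - M.cov j M.sch i k + ∑ s, M.wey k j s i * φ s := by
  have hH := M.hess_transpose hw hφ
  have hS := M.schDiff_transpose hw hφ
  have hB : (M.sch - M.schDiff φ)ᵀ = M.sch - M.schDiff φ := by
    rw [transpose_sub, M.sch_transpose, hS]
  set α := φ ᵥ* M.schMixed with hα
  set η := φ ᵥ* (M.Gi * M.hess φ) with hη
  have hW : ∑ s, M.wey k j s i * φ s = (φ ᵥ* M.Rm k j) i
      - (α k * M.G j i - α j * M.G k i - M.sch k i * φ j + M.sch j i * φ k) := by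
    simp only [wey, of_apply, hα, vecMul, dotProduct, sub_mul, add_mul, Finset.sum_sub_distrib,
      Finset.sum_add_distrib, Matrix.one_apply, mul_ite, mul_one, mul_zero, ite_mul, zero_mul,
      Finset.sum_ite_eq', Finset.mem_univ, if_true, Finset.sum_mul]
    have e1 : ∀ (f : Fin n → R), ∑ s, f s * φ s = ∑ s, φ s * f s := fun f =>
      Finset.sum_congr rfl fun s _ => mul_comm _ _
    have e2 : ∀ (f : Fin n → R) (c : R), ∑ s, f s * c * φ s = ∑ s, φ s * f s * c := fun f c =>
      Finset.sum_congr rfl fun s _ => by ring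
    rw [e1, e2, e2]
  have hcS : ∀ k i j, M.cov k (M.schDiff φ) i j = M.cov k (M.hess φ) i j
      - (M.hess φ k i * φ j + φ i * M.hess φ k j)
      + η k * M.G i j := by
    intro k i j
    have hN := M.derivation_normSq k hH
    have hc : M.D k (algebraMap ℝ R (1 / 2)) = 0 := (M.D k).map_algebraMap _
    have hP : M.cov k (vecMulVec φ φ) i j = M.hess φ k i * φ j + φ i * M.hess φ k j := by
      rw [cov_vecMulVec]; rfl
    rw [schDiff, cov_add, cov_sub, cov_smul, cov_G, Matrix.add_apply, Matrix.sub_apply, hP,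
      Derivation.leibniz, hc, hN]
    simp only [smul_zero, add_zero, Matrix.smul_apply, smul_eq_mul]
    linear_combination (η k * M.G i j) * half_mul_two (R := R)
  have hβ : ∀ k, (φ ᵥ* (M.Gi * (M.sch - M.schDiff φ))) k =
      α k - (η k - algebraMap ℝ R (1 / 2) * M.normSq φ * φ k) := by
    intro k
    have e1 : φ ᵥ* (M.Gi * vecMulVec φ φ) = M.normSq φ • φ := by
      rw [mul_vecMulVec, vecMul_vecMulVec, normSq]
    rw [schDiff, mul_sub, mul_add, mul_sub, vecMul_sub, vecMul_add, vecMul_sub, e1,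
      mul_smul_comm, M.inv_mul, vecMul_smul, vecMul_one]
    simp only [Pi.sub_apply, Pi.add_apply, Pi.smul_apply, smul_eq_mul]
    rw [← schMixed, ← hα, ← hη]
    linear_combination (-M.normSq φ * φ k) * half_mul_two (R := R)
  have hRic := M.cov_hess_sub k j i hH
  have e1 : ∀ a b, M.hess φ a b = M.hess φ b a := fun a b => congrFun (congrFun hH b) a
  rw [M.sch_scale hw hφ hn, M.cov_scale hw hφ k i j _ hB, M.cov_scale hw hφ j i k _ hB,
    M.cov_sub, M.cov_sub, hW]
  simp only [Matrix.sub_apply, hcS, hβ]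
  simp only [schDiff, Matrix.sub_apply, Matrix.add_apply, Matrix.smul_apply, vecMulVec_apply,
    smul_eq_mul]
  rw [M.sch_symm k i, M.sch_symm j i, M.sch_symm k j, e1 k i, e1 j i, e1 k j,
    M.G_apply_comm k i, M.G_apply_comm j i, M.G_apply_comm k j]
  -- The remaining terms in `φ`, its Hessian and `A` cancel; the Ricci identity supplies the Riemann
  -- term that `hW` splits off from the Weyl contraction.
  linear_combination (-1 : R) * hRic

end

end MetricAlgebra

end ConfGeom

/-! ### Divergence of the Newton tensors -/

namespace ConfGeom

open Matrix

namespace MetricAlgebra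

variable {n : ℕ} {R : Type*} [CommRing R] [Algebra ℝ R] (M : MetricAlgebra n R)

/-- `∇_t Aˡ_j - ∇_j Aˡ_t` for a `(1,1)`-tensor `A`. -/
noncomputable def covAlt (A : Matrix (Fin n) (Fin n) R) (l t j : Fin n) : R :=
  M.covMixed t A l j - M.covMixed j A l t

theorem covMixed_mul (k : Fin n) (A B : Matrix (Fin n) (Fin n) R) :
    M.covMixed k (A * B) = M.covMixed k A * B + A * M.covMixed k B := by
  simp only [covMixed, map_derivation_mul]; noncomm_ring

theorem covMixed_sub (k : Fin n) (A B : Matrix (Fin n) (Fin n) R) :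
    M.covMixed k (A - B) = M.covMixed k A - M.covMixed k B := by
  simp only [covMixed, map_derivation_sub]; noncomm_ring

theorem covMixed_smul_one (k : Fin n) (a : R) :
    M.covMixed k (a • (1 : Matrix (Fin n) (Fin n) R)) = M.D k a • 1 := by
  simp only [covMixed, map_derivation_smul, map_derivation_one, smul_zero, add_zero,
    mul_smul_comm, smul_mul_assoc, one_mul, mul_one]
  abel

/-- Partial derivatives may be replaced by covariant ones: the correction is `tr(T_k [Γ, A])`, zero
because `T_k` commutes with `A`. -/
theorem derivation_sigmaR_eq_trace_covMixed (A : Matrix (Fin n) (Fin n) R) (k : ℕ) (hk : k < n)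
    (r : Fin n) : M.D r (sigmaR (k + 1) A) = (newtonR A k * M.covMixed r A).trace := by
  rw [derivation_sigmaR _ _ _ hk, covMixed, mul_sub, mul_add, trace_sub, trace_add]
  have h : (newtonR A k * (M.Gam r * A)).trace = (newtonR A k * (A * M.Gam r)).trace := by
    rw [← mul_assoc, trace_mul_comm, ← mul_assoc, ← newtonR_commute, mul_assoc]
  rw [h]; ring

/-- In the divergence of `σ_{k+1} - T_k A`, the gradient of `σ_{k+1}` is `T_k` contracted with `∇_r
A`; it pairs with the term where `∇_j` falls on `A`. -/
theorem div_newtonR_succ (A : Matrix (Fin n) (Fin n) R) (k : ℕ) (hk : k < n) (r : Fin n) :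
    M.div (newtonR A (k + 1)) r = ∑ j, ∑ l, newtonR A k j l * M.covAlt A l r j
      - ∑ t, M.div (newtonR A k) t * A t r := by
  have h : ∀ j, M.covMixed j (newtonR A (k + 1)) j r =
      M.D j (sigmaR (k + 1) A) * (1 : Matrix (Fin n) (Fin n) R) j r
        - (∑ t, M.covMixed j (newtonR A k) j t * A t r
          + ∑ l, newtonR A k j l * M.covMixed j A l r) := by
    intro j
    rw [newtonR, covMixed_sub, covMixed_smul_one, covMixed_mul]
    simp only [Matrix.sub_apply, Matrix.smul_apply, Matrix.add_apply, smul_eq_mul, mul_apply]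
  have h1 : ∑ j, M.D j (sigmaR (k + 1) A) * (1 : Matrix (Fin n) (Fin n) R) j r =
      ∑ j, ∑ l, newtonR A k j l * M.covMixed r A l j := by
    simp only [Matrix.one_apply, mul_ite, mul_one, mul_zero, Finset.sum_ite_eq', Finset.mem_univ,
      if_true, M.derivation_sigmaR_eq_trace_covMixed A k hk, trace, diag_apply, mul_apply]
  simp only [div, h, Finset.sum_sub_distrib, Finset.sum_add_distrib, h1, covAlt, mul_sub,
    Finset.sum_mul]
  rw [Finset.sum_comm (f := fun t j => M.covMixed j (newtonR A k) j t * A t r)]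
  ring

/-- Each use of the recursion multiplies the earlier terms by `-A` on the right, whence the sign and
the power. -/
theorem div_newtonR (A : Matrix (Fin n) (Fin n) R) (k : ℕ) (hk : k < n) (r : Fin n) :
    M.div (newtonR A k) r = ∑ q ∈ Finset.range k, (-1) ^ (k - 1 - q) * ∑ j, ∑ l, ∑ t,
      newtonR A q j l * M.covAlt A l t j * (A ^ (k - 1 - q)) t r := by
  induction k generalizing r with
  | zero =>
    simp only [div, newtonR, Finset.range_zero, Finset.sum_empty]
    refine Finset.sum_eq_zero fun j _ => ?_
    have h := M.covMixed_smul_one j 1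
    rw [one_smul] at h
    rw [h]; simp
  | succ k ih =>
    have key : ∀ (c : Fin n → Fin n → Fin n → R) (X Y : Matrix (Fin n) (Fin n) R),
        ∑ s, (∑ j, ∑ l, ∑ t, c j l t * X t s) * Y s r =
          ∑ j, ∑ l, ∑ t, c j l t * (X * Y) t r := by
      intro c X Y
      simp only [mul_apply, Finset.sum_mul, Finset.mul_sum]
      rw [Finset.sum_comm]
      refine Finset.sum_congr rfl fun j _ => ?_
      rw [Finset.sum_comm]
      refine Finset.sum_congr rfl fun l _ => ?_
      rw [Finset.sum_comm]
      exact Finset.sum_congr rfl fun t _ => Finset.sum_congr rfl fun s _ => by ring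
    rw [div_newtonR_succ _ _ _ (by omega), Finset.sum_range_succ, sub_eq_add_neg, add_comm]
    congr 1
    · simp only [ih (by omega), Finset.sum_mul (s := Finset.range k)]
      rw [Finset.sum_comm, ← Finset.sum_neg_distrib]
      refine Finset.sum_congr rfl fun q hq => ?_
      have hq' : k + 1 - 1 - q = (k - 1 - q) + 1 := by
        have := Finset.mem_range.mp hq; omega
      rw [hq']
      simp only [pow_succ, mul_assoc ((-1 : R) ^ (k - 1 - q)), ← Finset.mul_sum, key]
      ring
    · simp [Matrix.one_apply]

/-- The divergence of the Newton tensors of the Schouten tensor. -/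
theorem div_newtonR_schMixed (hn : 3 ≤ n) (k : ℕ) (hk : k < n) (r : Fin n) :
    M.div (newtonR M.schMixed k) r = ∑ q ∈ Finset.Ico 1 k, (-1) ^ (k - 1 - q) *
      ∑ j, ∑ l, ∑ t, newtonR M.schMixed q j l * M.covAlt M.schMixed l t j *
        (M.schMixed ^ (k - 1 - q)) t r := by
  rw [M.div_newtonR _ k hk]
  rcases Nat.eq_zero_or_pos k with rfl | hpos
  · simp
  rw [Finset.range_eq_Ico, Finset.sum_eq_sum_Ico_succ_bot hpos]
  -- As `T_0 = 1`, the term `q = 0` contains only the trace of the antisymmetrized derivative.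
  have h : ∑ j, ∑ l, ∑ t, newtonR M.schMixed 0 j l * M.covAlt M.schMixed l t j *
        (M.schMixed ^ (k - 1 - 0)) t r = 0 := by
    simp only [newtonR, Matrix.one_apply, ite_mul, one_mul, zero_mul, Finset.sum_ite_irrel,
      Finset.sum_const_zero, Finset.sum_ite_eq, Finset.mem_univ, if_true]
    rw [Finset.sum_comm]
    refine Finset.sum_eq_zero fun t _ => ?_
    rw [← Finset.sum_mul]
    simp only [covAlt]
    rw [M.trace_cov_schMixed hn, zero_mul]
  rw [h, mul_zero, zero_add]

theorem div_newtonR_schMixed_eq_zero (hn : 3 ≤ n) (k : ℕ) (hk : k < n) (r : Fin n)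
    (h : k ≤ 1 ∨ ∀ l t j, M.covAlt M.schMixed l t j = 0) :
    M.div (newtonR M.schMixed k) r = 0 := by
  rw [M.div_newtonR_schMixed hn k hk]
  rcases h with h | h
  · rw [Finset.Ico_eq_empty (by omega), Finset.sum_empty]
  · simp [h]

/-- Supplies the symmetry required by `div_scale`; the induction uses that `T_k` and `A` commute. -/
theorem transpose_G_mul_newtonR (A : Matrix (Fin n) (Fin n) R) (hA : (M.G * A)ᵀ = M.G * A)
    (k : ℕ) : (M.G * newtonR A k)ᵀ = M.G * newtonR A k := by
  induction k with
  | zero => simp [newtonR, M.symm]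
  | succ k ih =>
    have hA' : Aᵀ * M.G = M.G * A := by rw [← hA, transpose_mul, M.symm]
    have ih' : (newtonR A k)ᵀ * M.G = M.G * newtonR A k := by rw [← ih, transpose_mul, M.symm]
    have h : (M.G * (newtonR A k * A))ᵀ = M.G * (newtonR A k * A) := by
      rw [transpose_mul, transpose_mul, M.symm, mul_assoc, ih', ← mul_assoc, hA', mul_assoc,
        newtonR_commute]
    rw [newtonR, mul_sub, transpose_sub, h, mul_smul_comm, transpose_smul, mul_one, M.symm]

variable {φ : Fin n → R} {w wi : R} (hw : w * wi = 1) (hφ : ∀ i, M.D i w = 2 * w * φ i)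

section
include hw hφ

/-- The conformal change of the divergence of a symmetric `(1,1)`-tensor. -/
theorem div_scale (T : Matrix (Fin n) (Fin n) R) (hT : (M.G * T)ᵀ = M.G * T) (r : Fin n) :
    (M.scale w wi hw).div T r = M.div T r + n * ∑ j, φ j * T j r - φ r * T.trace := by
  have hcov : ∀ j, (M.scale w wi hw).covMixed j T =
      M.covMixed j T + M.Gi * M.wedgeRow φ j * T - T * M.Gi * M.wedgeRow φ j := by
    intro j
    rw [covMixed, M.Gam_scale hw hφ, covMixed]
    have hD : (M.scale w wi hw).D = M.D := rfl
    rw [hD]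
    simp only [add_mul, mul_add, smul_mul_assoc, mul_smul_comm, one_mul, mul_one]
    noncomm_ring
  have hrow : ∀ j (X : Matrix (Fin n) (Fin n) R), M.G j ᵥ* X = (M.G * X) j := by
    intro j X; funext q; simp [vecMul, mul_apply, dotProduct]
  have h1 : ∀ j, (M.Gi * M.wedgeRow φ j * T) j r =
      (φ ᵥ* T) r - (M.Gi *ᵥ φ) j * (M.G * T) j r := by
    intro j
    simp only [wedgeRow, mul_sub, sub_mul, mul_vecMulVec, vecMulVec_mul, Matrix.sub_apply,
      vecMulVec_apply, Gi_mulVec_G_row, hrow]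
    simp
  have h2 : ∀ j, (T * M.Gi * M.wedgeRow φ j) j r =
      T j j * φ r - ((T * M.Gi) *ᵥ φ) j * M.G j r := by
    intro j
    simp only [wedgeRow, mul_sub, mul_vecMulVec, Matrix.sub_apply, vecMulVec_apply]
    rw [← mulVec_mulVec, Gi_mulVec_G_row]
    simp
  -- This contraction cancels against `h4`, where the symmetry of `T` enters, so the coefficient of
  -- `φ T` is exactly `n`.
  have h3 : ∑ j, (M.Gi *ᵥ φ) j * (M.G * T) j r = (φ ᵥ* T) r := by
    have e : ∑ j, (M.Gi *ᵥ φ) j * (M.G * T) j r = ((M.Gi *ᵥ φ) ᵥ* (M.G * T)) r := rfl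
    rw [e, ← vecMul_transpose, M.Gi_symm, vecMul_vecMul, ← mul_assoc, M.inv_mul, one_mul]
  have h4 : ∑ j, ((T * M.Gi) *ᵥ φ) j * M.G j r = (φ ᵥ* T) r := by
    have e : ∑ j, ((T * M.Gi) *ᵥ φ) j * M.G j r = (((T * M.Gi) *ᵥ φ) ᵥ* M.G) r := rfl
    have hT' : Tᵀ * M.G = M.G * T := by rw [← hT, transpose_mul, M.symm]
    rw [e, ← vecMul_transpose, transpose_mul, M.Gi_symm, vecMul_vecMul, mul_assoc, hT',
      ← mul_assoc, M.inv_mul, one_mul]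
  have h5 : (φ ᵥ* T) r = ∑ j, φ j * T j r := rfl
  simp only [div, hcov, Matrix.sub_apply, Matrix.add_apply, h1, h2, Finset.sum_add_distrib,
    Finset.sum_sub_distrib, h3, h4, trace, diag_apply, ← Finset.sum_mul, Finset.sum_const,
    Finset.card_univ, Fintype.card_fin, nsmul_eq_mul, h5]
  ring

end

theorem wey_antisymm (i j l q : Fin n) : M.wey i j l q = -M.wey j i l q := by
  simp only [wey, of_apply]
  rw [M.Rm_antisymm i j, Matrix.neg_apply]; ring

/-- Inherited from the curvature, since the Schouten terms are antisymmetric too. It is used to move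
the contraction with `φ` from the upper slot of `W` to the lower one. -/
theorem wey_mul_inv_apply (i j l p : Fin n) :
    (M.wey i j * M.Gi) l p = -(M.wey i j * M.Gi) p l := by
  have hS : ∀ a b, ∑ q, M.sch a q * M.Gi q b = M.schMixed b a := by
    intro a b
    rw [schMixed, mul_apply]
    exact Finset.sum_congr rfl fun q _ => by rw [M.sch_symm, M.Gi_apply_comm, mul_comm]
  have hG : ∀ a b, ∑ q, M.G a q * M.Gi q b = (1 : Matrix (Fin n) (Fin n) R) a b := by
    intro a b
    rw [← M.mul_inv, mul_apply]
  have h : ∀ l p, (M.wey i j * M.Gi) l p = (M.Rm i j * M.Gi) l p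
      - (M.schMixed l i * (1 : Matrix (Fin n) (Fin n) R) j p
        - M.schMixed l j * (1 : Matrix (Fin n) (Fin n) R) i p
        - M.schMixed p i * (1 : Matrix (Fin n) (Fin n) R) l j
        + M.schMixed p j * (1 : Matrix (Fin n) (Fin n) R) l i) := by
    intro l p
    rw [← hG j p, ← hG i p, ← hS i p, ← hS j p]
    simp only [mul_apply, wey, of_apply, Finset.mul_sum, Finset.sum_mul,
      ← Finset.sum_sub_distrib, ← Finset.sum_add_distrib]
    exact Finset.sum_congr rfl fun q _ => by ring
  have hone : ∀ a b, (1 : Matrix (Fin n) (Fin n) R) a b = (1 : Matrix (Fin n) (Fin n) R) b a := by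
    intro a b; simp only [Matrix.one_apply, eq_comm]
  rw [h, h, M.Rm_mul_inv_apply, hone p j, hone p i, hone l j, hone l i]
  ring

/-- The Cotton tensor with its first index raised. -/
noncomputable def cotUp (l i j : Fin n) : R :=
  ∑ m, M.Gi l m * (((n : R) - 2) * (M.cov j M.sch m i - M.cov i M.sch m j))

section
include hw hφ

/-- Raises the index in `cov_sch_scale` with `wi • Gi`. The overall minus sign comes from the index
order in the Cotton tensor and later turns `(-1)^(k-1-q)` into `(-1)^(k-q)`. -/
theorem covAlt_schMixed_scale (hn : 3 ≤ n) (l t j : Fin n) :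
    (M.scale w wi hw).covAlt (M.scale w wi hw).schMixed l t j =
      -(algebraMap ℝ R (1 / ((n : ℝ) - 2)) * wi *
        (-((n : R) - 2) * ∑ m, M.wey j t l m * (M.Gi *ᵥ φ) m + M.cotUp l t j)) := by
  have h1 : (M.scale w wi hw).covAlt (M.scale w wi hw).schMixed l t j =
      wi * ∑ m, M.Gi l m * (M.cov t M.sch m j - M.cov j M.sch m t + ∑ s, M.wey t j s m * φ s) := by
    simp only [covAlt, schMixed, covMixed_inv_mul]
    simp only [mul_apply, ← Finset.sum_sub_distrib, ← mul_sub, M.cov_sch_scale hw hφ hn,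
      Finset.mul_sum]
    exact Finset.sum_congr rfl fun m _ => mul_assoc wi (M.Gi l m) _
  have h2 : ∑ m, M.Gi l m * ∑ s, M.wey t j s m * φ s = ∑ m, M.wey j t l m * (M.Gi *ᵥ φ) m := by
    have e1 : ∑ m, M.Gi l m * ∑ s, M.wey t j s m * φ s = ∑ s, (M.wey t j * M.Gi) s l * φ s := by
      simp only [mul_apply, Finset.mul_sum, Finset.sum_mul]
      rw [Finset.sum_comm]
      refine Finset.sum_congr rfl fun s _ => Finset.sum_congr rfl fun m _ => ?_
      rw [M.Gi_apply_comm l m]; ring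
    have e2 : ∑ m, M.wey j t l m * (M.Gi *ᵥ φ) m = ∑ s, (M.wey j t * M.Gi) l s * φ s := by
      simp only [mul_apply, mulVec, dotProduct, Finset.mul_sum, Finset.sum_mul]
      rw [Finset.sum_comm]
      exact Finset.sum_congr rfl fun s _ => Finset.sum_congr rfl fun m _ => by ring
    rw [e1, e2]
    refine Finset.sum_congr rfl fun s _ => ?_
    rw [M.wey_mul_inv_apply t j s l]
    have e3 : (M.wey t j * M.Gi) l s = -(M.wey j t * M.Gi) l s := by
      simp only [mul_apply, ← Finset.sum_neg_distrib]
      exact Finset.sum_congr rfl fun m _ => by rw [M.wey_antisymm t j, neg_mul]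
    rw [e3, neg_neg]
  have ha := algebraMap_sub_two_inv (R := R) hn
  have h3 : M.cotUp l t j = -(((n : R) - 2) *
      ∑ m, M.Gi l m * (M.cov t M.sch m j - M.cov j M.sch m t)) := by
    rw [cotUp, Finset.mul_sum, ← Finset.sum_neg_distrib]
    exact Finset.sum_congr rfl fun m _ => by ring
  rw [h1, h3]
  simp only [mul_add, Finset.sum_add_distrib, h2]
  linear_combination (-wi * (∑ m, M.wey j t l m * (M.Gi *ᵥ φ) m
    + ∑ m, M.Gi l m * (M.cov t M.sch m j - M.cov j M.sch m t))) * ha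

/-- The divergence, with respect to a metric, of the Newton tensors of the Schouten tensor of a
conformal metric. -/
theorem div_newtonR_schMixed_scale (hn : 3 ≤ n) (k : ℕ) (hk : k < n) (r : Fin n)
    (A : Matrix (Fin n) (Fin n) R) (hA : A = (M.scale w wi hw).schMixed) :
    M.div (newtonR A k) r =
      -(∑ j, φ j * (n * newtonR A k j r
        - ((n : R) - k) * sigmaR k A * (1 : Matrix (Fin n) (Fin n) R) j r))
      + algebraMap ℝ R (1 / ((n : ℝ) - 2)) * wi * ∑ q ∈ Finset.Ico 1 k, (-1) ^ (k - q) *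
        ∑ j, ∑ l, ∑ t, newtonR A q j l *
          (-((n : R) - 2) * ∑ m, M.wey j t l m * (M.Gi *ᵥ φ) m + M.cotUp l t j) *
            (A ^ (k - 1 - q)) t r := by
  have hGA : (M.G * A)ᵀ = M.G * A := by
    have h : M.G * A = wi • (M.scale w wi hw).sch := by
      have e : A = wi • (M.Gi * (M.scale w wi hw).sch) := by
        rw [hA, schMixed, ← smul_mul_assoc]; rfl
      rw [e, mul_smul_comm, ← mul_assoc, M.mul_inv, one_mul]
    rw [h, transpose_smul, sch_transpose]
  have h1 := M.div_scale hw hφ (newtonR A k) (M.transpose_G_mul_newtonR A hGA k) r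
  have h2 : (M.scale w wi hw).div (newtonR A k) r =
      algebraMap ℝ R (1 / ((n : ℝ) - 2)) * wi * ∑ q ∈ Finset.Ico 1 k, (-1) ^ (k - q) *
        ∑ j, ∑ l, ∑ t, newtonR A q j l *
          (-((n : R) - 2) * ∑ m, M.wey j t l m * (M.Gi *ᵥ φ) m + M.cotUp l t j) *
            (A ^ (k - 1 - q)) t r := by
    rw [hA, (M.scale w wi hw).div_newtonR_schMixed hn k hk, Finset.mul_sum]
    refine Finset.sum_congr rfl fun q hq => ?_
    have hq' : k - q = (k - 1 - q) + 1 := by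
      have := Finset.mem_Ico.mp hq; omega
    rw [hq', pow_succ]
    simp only [M.covAlt_schMixed_scale hw hφ hn]
    have key : ∀ (c : R) (T X : Matrix (Fin n) (Fin n) R) (x : Fin n → Fin n → Fin n → R),
        ∑ j, ∑ l, ∑ t, T j l * (-(c * x j l t)) * X t r =
          -(c * ∑ j, ∑ l, ∑ t, T j l * x j l t * X t r) := by
      intro c T X x
      simp only [Finset.mul_sum, ← Finset.sum_neg_distrib]
      exact Finset.sum_congr rfl fun j _ => Finset.sum_congr rfl fun l _ =>
        Finset.sum_congr rfl fun t _ => by ring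
    rw [key]
    ring
  have h3 : ∑ j, φ j * (n * newtonR A k j r
        - ((n : R) - k) * sigmaR k A * (1 : Matrix (Fin n) (Fin n) R) j r) =
      n * ∑ j, φ j * newtonR A k j r - φ r * (((n : R) - k) * sigmaR k A) := by
    simp only [mul_sub, Finset.sum_sub_distrib, Matrix.one_apply, mul_ite, mul_one, mul_zero,
      Finset.sum_ite_eq', Finset.mem_univ, if_true, Finset.mul_sum]
    congr 1
    exact Finset.sum_congr rfl fun j _ => by ring
  rw [trace_newtonR A k hk, h2] at h1
  rw [h3]
  linear_combination -h1

/-- A flat base metric has vanishing Schouten, Weyl and Cotton tensors, so nothing is left in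
`covAlt_schMixed_scale`. -/
theorem covAlt_schMixed_scale_eq_zero (hn : 3 ≤ n) (hflat : ∀ i j, M.Rm i j = 0) (l t j : Fin n) :
    (M.scale w wi hw).covAlt (M.scale w wi hw).schMixed l t j = 0 := by
  have hric : M.ric = 0 := by ext i j; simp [ric, hflat]
  have hscal : M.scal = 0 := by simp [scal, hric]
  have hsch : M.sch = 0 := by rw [sch_eq, hric, hscal]; simp
  have hmix : M.schMixed = 0 := by rw [schMixed, hsch, mul_zero]
  have hcov : ∀ k, M.cov k M.sch = 0 := by
    intro k
    rw [hsch, cov]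
    ext; simp
  have hwey : ∀ i j l q, M.wey i j l q = 0 := by
    intro i j l q; simp [wey, hflat, hmix, hsch]
  rw [M.covAlt_schMixed_scale hw hφ hn]
  simp [cotUp, hcov, hwey]

end

end MetricAlgebra

end ConfGeom

/-! ### Smooth functions on a coordinate domain as a metric algebra -/

namespace ConfGeom

open Matrix

variable {n : ℕ}

section PartialDerivatives

variable {s : Set (Euc n)} {f g : Euc n → ℝ} {y : Euc n}

theorem pd_congr (hy : y ∈ s) (h : ∀ z ∈ s, f z = g z) (i : Fin n) : pd s i f y = pd s i g y := by
  rw [pd, pd, fderivWithin_congr (fun z hz => h z hz) (h y hy)]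

theorem pd_inter {O : Set (Euc n)} (hO : IsOpen O) (hy : y ∈ O) (i : Fin n) :
    pd (s ∩ O) i f y = pd s i f y := by
  rw [pd, pd, fderivWithin_inter (hO.mem_nhds hy)]

theorem contDiffOn_pd (hs : UniqueDiffOn ℝ s) (hf : ContDiffOn ℝ ∞ f s) (i : Fin n) :
    ContDiffOn ℝ ∞ (pd s i f) s :=
  (hf.fderivWithin hs le_rfl).clm_apply contDiffOn_const

theorem pd_add (hs : UniqueDiffOn ℝ s) (hf : ContDiffOn ℝ ∞ f s) (hg : ContDiffOn ℝ ∞ g s)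
    (hy : y ∈ s) (i : Fin n) : pd s i (fun z => f z + g z) y = pd s i f y + pd s i g y := by
  simp only [pd]
  rw [fderivWithin_fun_add (hs y hy) ((hf.differentiableOn (by simp)) y hy)
    ((hg.differentiableOn (by simp)) y hy)]
  rfl

theorem pd_mul (hs : UniqueDiffOn ℝ s) (hf : ContDiffOn ℝ ∞ f s) (hg : ContDiffOn ℝ ∞ g s)
    (hy : y ∈ s) (i : Fin n) :
    pd s i (fun z => f z * g z) y = f y * pd s i g y + g y * pd s i f y := by
  simp only [pd]
  rw [fderivWithin_fun_mul (hs y hy) ((hf.differentiableOn (by simp)) y hy)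
    ((hg.differentiableOn (by simp)) y hy)]
  rfl

theorem pd_const (c : ℝ) (i : Fin n) : pd s i (fun _ => c) y = 0 := by
  simp [pd]

/-- At boundary points the symmetry of one-sided second derivatives holds because the point is a
limit of interior points. -/
theorem pd_comm (hs : UniqueDiffOn ℝ s) (hs' : s ⊆ closure (interior s))
    (hf : ContDiffOn ℝ ∞ f s) (hy : y ∈ s) (i j : Fin n) :
    pd s i (pd s j f) y = pd s j (pd s i f) y := by
  have hsymm : IsSymmSndFDerivWithinAt ℝ f s y :=
    (hf y hy).isSymmSndFDerivWithinAt
      (by rw [minSmoothness_of_isRCLikeNormedField]; exact WithTop.coe_le_coe.2 le_top) hs (hs' hy) hy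
  have hd : DifferentiableWithinAt ℝ (fderivWithin ℝ f s) s y :=
    ((hf.fderivWithin hs (m := ∞) le_rfl).differentiableOn (by simp)) y hy
  have h : ∀ i j, pd s i (pd s j f) y = fderivWithin ℝ (fderivWithin ℝ f s) s y
      (EuclideanSpace.single i 1) (EuclideanSpace.single j 1) := by
    intro i j
    have e : pd s j f = fun z => (fderivWithin ℝ f s z) (EuclideanSpace.single j 1) := rfl
    rw [e, pd, fderivWithin_clm_apply (hs y hy) hd (differentiableWithinAt_const _)]
    simp
  rw [h, h, hsymm]

end PartialDerivatives

/-- The algebra of (restrictions to `s` of) functions that are smooth on `s`. -/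
def smoothFun (s : Set (Euc n)) : Subalgebra ℝ (s → ℝ) where
  carrier := {f | ∃ F : Euc n → ℝ, ContDiffOn ℝ ∞ F s ∧ ∀ y : s, F y = f y}
  mul_mem' := by
    rintro a b ⟨F, hF, hFa⟩ ⟨F', hF', hFb⟩
    exact ⟨fun z => F z * F' z, hF.mul hF', fun y => by simp [hFa, hFb]⟩
  add_mem' := by
    rintro a b ⟨F, hF, hFa⟩ ⟨F', hF', hFb⟩
    exact ⟨fun z => F z + F' z, hF.add hF', fun y => by simp [hFa, hFb]⟩
  algebraMap_mem' := fun c => ⟨fun _ => c, contDiffOn_const, fun _ => rfl⟩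

namespace smoothFun

variable {s : Set (Euc n)}

/-- Evaluation at a point of `s`. -/
def ev (y : s) : smoothFun s →ₐ[ℝ] ℝ := (Pi.evalAlgHom ℝ (fun _ : s => ℝ) y).comp (smoothFun s).val

theorem ext_ev {f g : smoothFun s} (h : ∀ y, ev y f = ev y g) : f = g :=
  Subtype.ext (funext h)

/-- The element of `smoothFun s` given by a function that is smooth on `s`. -/
def of (F : Euc n → ℝ) (hF : ContDiffOn ℝ ∞ F s) : smoothFun s :=
  ⟨fun y => F y, F, hF, fun _ => rfl⟩

@[simp]
theorem ev_of (F : Euc n → ℝ) (hF : ContDiffOn ℝ ∞ F s) (y : s) : ev y (of F hF) = F y := rfl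

/-- A smooth representative of an element of `smoothFun s`. -/
noncomputable def rep (f : smoothFun s) : Euc n → ℝ := f.2.choose

theorem contDiffOn_rep (f : smoothFun s) : ContDiffOn ℝ ∞ (rep f) s := f.2.choose_spec.1

theorem rep_apply (f : smoothFun s) (y : s) : rep f y = ev y f := f.2.choose_spec.2 y

/-- The partial derivative as a derivation of `smoothFun s`. -/
noncomputable def partialDeriv (hs : UniqueDiffOn ℝ s) (i : Fin n) :
    Derivation ℝ (smoothFun s) (smoothFun s) :=
  Derivation.mk' (R := ℝ)
    { toFun := fun f => of (pd s i (rep f)) (contDiffOn_pd hs (contDiffOn_rep f) i)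
      map_add' := fun f g => ext_ev fun y => by
        rw [map_add, ev_of, ev_of, ev_of, ← pd_add hs (contDiffOn_rep f) (contDiffOn_rep g) y.2]
        refine pd_congr y.2 (fun z hz => ?_) i
        have h := fun f => rep_apply f (⟨z, hz⟩ : s)
        rw [h, h, h, map_add]
      map_smul' := fun c f => ext_ev fun y => by
        rw [RingHom.id_apply, map_smul, ev_of, ev_of, smul_eq_mul]
        have e : pd s i (rep (c • f)) y = pd s i (fun z => c * rep f z) y := by
          refine pd_congr y.2 (fun z hz => ?_) i
          have h := fun f => rep_apply f (⟨z, hz⟩ : s)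
          rw [h, h, map_smul, smul_eq_mul]
        rw [e, pd_mul hs contDiffOn_const (contDiffOn_rep f) y.2, pd_const, mul_zero, add_zero] }
    fun f g => ext_ev fun y => by
      simp only [LinearMap.coe_mk, AddHom.coe_mk, smul_eq_mul]
      rw [map_add, map_mul, map_mul, ev_of, ev_of, ev_of, ← rep_apply, ← rep_apply,
        ← pd_mul hs (contDiffOn_rep f) (contDiffOn_rep g) y.2]
      refine pd_congr y.2 (fun z hz => ?_) i
      have h := fun f => rep_apply f (⟨z, hz⟩ : s)
      rw [h, h, h, map_mul]

/-- The chosen representative is immaterial: derivatives within `s` see only values on `s`. -/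
theorem ev_partialDeriv (hs : UniqueDiffOn ℝ s) (i : Fin n) (f : smoothFun s) (F : Euc n → ℝ)
    (h : ∀ y : s, F y = ev y f) (y : s) : ev y (partialDeriv hs i f) = pd s i F y :=
  pd_congr y.2 (fun z hz => by rw [rep_apply f ⟨z, hz⟩, ← h]) i

theorem partialDeriv_comm (hs : UniqueDiffOn ℝ s) (hs' : s ⊆ closure (interior s)) (i j : Fin n)
    (f : smoothFun s) :
    partialDeriv hs i (partialDeriv hs j f) = partialDeriv hs j (partialDeriv hs i f) := by
  refine ext_ev fun y => ?_
  rw [ev_partialDeriv hs i _ (pd s j (rep f)) (fun _ => rfl),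
    ev_partialDeriv hs j _ (pd s i (rep f)) (fun _ => rfl),
    pd_comm hs hs' (contDiffOn_rep f) y.2]

theorem isUnit_of_ev_ne_zero (f : smoothFun s) (h : ∀ y, ev y f ≠ 0) : IsUnit f := by
  refine IsUnit.of_mul_eq_one (of (fun z => (rep f z)⁻¹) ((contDiffOn_rep f).inv fun z hz => ?_)) ?_
  · rw [rep_apply f ⟨z, hz⟩]; exact h _
  · refine ext_ev fun y => ?_
    rw [map_mul, ev_of, rep_apply, map_one, mul_inv_cancel₀ (h y)]

end smoothFun

open smoothFun

/-- The metric algebra of the smooth functions on a coordinate domain. -/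
noncomputable def coordAlgebra {s : Set (Euc n)} (hs : UniqueDiffOn ℝ s)
    (hs' : s ⊆ closure (interior s)) (G : Euc n → Matrix (Fin n) (Fin n) ℝ)
    (hG : ∀ i j, ContDiffOn ℝ ∞ (fun z => G z i j) s) (hsymm : ∀ z ∈ s, (G z)ᵀ = G z)
    (hdet : ∀ z ∈ s, (G z).det ≠ 0) : MetricAlgebra n (smoothFun s) where
  D := partialDeriv hs
  D_comm := partialDeriv_comm hs hs'
  G := Matrix.of fun i j => smoothFun.of _ (hG i j)
  Gi := (Matrix.of fun i j => smoothFun.of _ (hG i j))⁻¹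
  symm := by
    ext1 i j
    refine ext_ev fun y => ?_
    exact congrFun (congrFun (hsymm y y.2) i) j
  mul_inv := by
    refine Matrix.mul_nonsing_inv _ (isUnit_of_ev_ne_zero _ fun y => ?_)
    rw [AlgHom.map_det]
    exact hdet y y.2

/-- The metric algebra `M` of smooth functions on `t` computes the geometry of the metric `G` on a
coordinate domain `s`, of which `t` is a relatively open part. -/
structure Represents (s : Set (Euc n)) (G : Euc n → Matrix (Fin n) (Fin n) ℝ) {t : Set (Euc n)}
    (M : MetricAlgebra n (smoothFun t)) : Prop where
  uniqueDiffOn : UniqueDiffOn ℝ t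
  pd_eq : ∀ (i : Fin n) (f : Euc n → ℝ), ∀ y ∈ t, pd s i f y = pd t i f y
  D_eq : M.D = partialDeriv uniqueDiffOn
  G_eq : ∀ (y : t) (i j : Fin n), G y i j = ev y (M.G i j)

namespace Represents

variable {s t : Set (Euc n)} {G : Euc n → Matrix (Fin n) (Fin n) ℝ}
  {M : MetricAlgebra n (smoothFun t)} (h : Represents s G M)
include h

theorem pd_apply (i : Fin n) (F : Euc n → ℝ) (f : smoothFun t) (hF : ∀ y : t, F y = ev y f)
    (y : t) : pd s i F y = ev y (M.D i f) := by
  rw [h.pd_eq i F y y.2, h.D_eq, ev_partialDeriv h.uniqueDiffOn i f F hF]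

theorem inv_apply (y : t) (i j : Fin n) : (G y)⁻¹ i j = ev y (M.Gi i j) := by
  have h1 : G y = M.G.map (ev y) := by ext a b; exact h.G_eq y a b
  have h2 : G y * M.Gi.map (ev y) = 1 := by
    rw [h1, ← Matrix.map_mul, M.mul_inv]
    exact Matrix.map_one _ (map_zero _) (map_one _)
  rw [Matrix.inv_eq_right_inv h2]; rfl

theorem christoffel_apply (y : t) (l i j : Fin n) :
    christoffel s G l i j y = ev y (M.Gam i l j) := by
  have hpd : ∀ i j m, pd s i (fun z => G z j m) y = ev y (M.D i (M.G j m)) := fun i j m =>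
    h.pd_apply i _ (M.G j m) (fun y => h.G_eq y j m) y
  simp only [christoffel, MetricAlgebra.Gam, Matrix.of_apply, map_mul, map_sum, map_add, map_sub,
    AlgHom.commutes, h.inv_apply, hpd]
  rfl

theorem riem_apply (y : t) (i j l q : Fin n) : riem s G i j l q y = ev y (M.Rm i j l q) := by
  simp only [riem, MetricAlgebra.Rm, Matrix.add_apply, Matrix.sub_apply, Matrix.map_apply,
    Matrix.mul_apply, map_add, map_sub, map_sum, map_mul, h.christoffel_apply,
    Finset.sum_sub_distrib]
  rw [h.pd_apply i _ (M.Gam j l q) (fun y => h.christoffel_apply y _ _ _),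
    h.pd_apply j _ (M.Gam i l q) (fun y => h.christoffel_apply y _ _ _)]

theorem ricci_apply (y : t) (j q : Fin n) : ricci s G j q y = ev y (M.ric j q) := by
  simp only [ricci, MetricAlgebra.ric, Matrix.of_apply, map_sum, h.riem_apply]

theorem scalarCurv_apply (y : t) : scalarCurv s G y = ev y M.scal := by
  simp only [scalarCurv, MetricAlgebra.scal, map_sum, map_mul, h.ricci_apply, h.inv_apply]

theorem schouten_apply (y : t) (i j : Fin n) : schouten s G i j y = ev y (M.sch i j) := by
  simp only [schouten, MetricAlgebra.sch, Matrix.of_apply, map_sub, map_mul, h.ricci_apply,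
    h.scalarCurv_apply, AlgHom.commutes, h.G_eq, Algebra.algebraMap_self, RingHom.id_apply]
  ring

theorem schoutenMixed_apply (y : t) : schoutenMixed s G y = M.schMixed.map (ev y) := by
  ext i j
  simp only [schoutenMixed, MetricAlgebra.schMixed, Matrix.of_apply, Matrix.map_apply,
    Matrix.mul_apply, map_sum, map_mul, h.inv_apply, h.schouten_apply]

theorem weyl_apply (y : t) (i j l q : Fin n) : weyl s G i j l q y = ev y (M.wey i j l q) := by
  simp only [weyl, MetricAlgebra.wey, Matrix.of_apply, map_sub, map_add, map_mul, h.riem_apply,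
    h.schoutenMixed_apply, h.schouten_apply, h.G_eq, Matrix.map_apply, Matrix.one_apply,
    apply_ite (ev y), map_one, map_zero]

theorem covSchouten_apply (y : t) (k i j : Fin n) :
    covSchouten s G k i j y = ev y (M.cov k M.sch i j) := by
  simp only [covSchouten, MetricAlgebra.cov, Matrix.sub_apply, Matrix.map_apply, Matrix.mul_apply,
    Matrix.transpose_apply, map_sub, map_sum, map_mul, h.christoffel_apply, h.schouten_apply,
    Finset.sum_add_distrib]
  rw [h.pd_apply k _ (M.sch i j) (fun y => h.schouten_apply y _ _), sub_sub]
  congr 2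
  exact Finset.sum_congr rfl fun m _ => mul_comm _ _

theorem cottonUp_apply (y : t) (l i j : Fin n) : cottonUp s G l i j y = ev y (M.cotUp l i j) := by
  simp only [cottonUp, cotton, MetricAlgebra.cotUp, map_sum, map_mul, map_sub, map_natCast,
    map_ofNat, h.inv_apply, h.covSchouten_apply]

theorem divMixed_apply (y : t) (T : Euc n → Matrix (Fin n) (Fin n) ℝ)
    (S : Matrix (Fin n) (Fin n) (smoothFun t)) (hT : ∀ y : t, T y = S.map (ev y)) (r : Fin n) :
    divMixed s G T r y = ev y (M.div S r) := by
  simp only [divMixed, MetricAlgebra.div, MetricAlgebra.covMixed, Matrix.sub_apply,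
    Matrix.add_apply, Matrix.map_apply, Matrix.mul_apply, map_sub, map_add, map_sum, map_mul,
    h.christoffel_apply, hT, Finset.sum_sub_distrib, Finset.sum_add_distrib]
  have hpd : ∀ j, pd s j (fun z => T z j r) y = ev y (M.D j (S j r)) := fun j =>
    h.pd_apply j _ (S j r) (fun y => by rw [hT]; rfl) y
  have hcomm : ∀ j, ∑ m, ev y (M.Gam j m r) * ev y (S j m) =
      ∑ m, ev y (S j m) * ev y (M.Gam j m r) := fun j =>
    Finset.sum_congr rfl fun m _ => mul_comm _ _
  simp only [hpd, hcomm]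
  ring

end Represents

theorem represents_coordAlgebra {s O : Set (Euc n)} (hO : IsOpen O) (hs : UniqueDiffOn ℝ (s ∩ O))
    (hs' : s ∩ O ⊆ closure (interior (s ∩ O))) (G : Euc n → Matrix (Fin n) (Fin n) ℝ)
    (hG : ∀ i j, ContDiffOn ℝ ∞ (fun z => G z i j) (s ∩ O)) (hsymm : ∀ z ∈ s ∩ O, (G z)ᵀ = G z)
    (hdet : ∀ z ∈ s ∩ O, (G z).det ≠ 0) :
    Represents s G (coordAlgebra hs hs' G hG hsymm hdet) where
  uniqueDiffOn := hs
  pd_eq := fun i _ _ hy => (pd_inter hO hy.2 i).symm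
  D_eq := rfl
  G_eq := fun _ _ _ => rfl

theorem Represents.scale {s t : Set (Euc n)} {G G' : Euc n → Matrix (Fin n) (Fin n) ℝ}
    {M : MetricAlgebra n (smoothFun t)} (h : Represents s G M) {w wi : smoothFun t}
    (hw : w * wi = 1) (hG' : ∀ (y : t) (i j : Fin n), G' y i j = ev y w * G y i j) :
    Represents s G' (M.scale w wi hw) where
  uniqueDiffOn := h.uniqueDiffOn
  pd_eq := h.pd_eq
  D_eq := h.D_eq
  G_eq := fun y i j => by
    rw [hG', h.G_eq, ← map_mul]; rfl

end ConfGeom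

/-! ### The divergence identities in one coordinate domain -/

namespace ConfGeom

open Matrix smoothFun

variable {n : ℕ}

theorem pd_rpow {s : Set (Euc n)} {v : Euc n → ℝ} {y : Euc n} (hs : UniqueDiffOn ℝ s)
    (hv : ContDiffOn ℝ ∞ v s) (hy : y ∈ s) (hpos : 0 < v y) (p : ℝ) (i : Fin n) :
    pd s i (fun z => v z ^ p) y = p * v y ^ (p - 1) * pd s i v y := by
  have h := ((hv.differentiableOn (by simp)) y hy).hasFDerivWithinAt.rpow_const (p := p)
    (Or.inl hpos.ne')
  rw [pd, h.fderivWithin (hs y hy)]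
  rfl

section Conformal

variable {s t : Set (Euc n)} {G Gu : Euc n → Matrix (Fin n) (Fin n) ℝ}
  {M : MetricAlgebra n (smoothFun t)} (h : Represents s G M)

/-- Half the logarithmic differential of `w`. -/
noncomputable def halfLogDeriv (M : MetricAlgebra n (smoothFun t)) (w wi : smoothFun t)
    (i : Fin n) : smoothFun t :=
  algebraMap ℝ (smoothFun t) (1 / 2) * wi * M.D i w

theorem D_eq_halfLogDeriv (M : MetricAlgebra n (smoothFun t)) {w wi : smoothFun t}
    (hw : w * wi = 1) (i : Fin n) : M.D i w = 2 * w * halfLogDeriv M w wi i := by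
  rw [halfLogDeriv]
  linear_combination (-M.D i w) * hw
    - M.D i w * w * wi * MetricAlgebra.half_mul_two (R := smoothFun t)

include h

theorem Represents.newton_apply (k : ℕ) (hk : k < n) (y : t) :
    newton k (schoutenMixed s G y) = (newtonR M.schMixed k).map (ev y) := by
  rw [newton_eq_newtonR k hk, h.schoutenMixed_apply]
  exact newtonR_map (ev y : smoothFun t →+* ℝ) k M.schMixed

theorem Represents.sigma_apply (k : ℕ) (y : t) :
    sigma k (schoutenMixed s G y) = ev y (sigmaR k M.schMixed) := by
  rw [sigma_eq_sigmaR, h.schoutenMixed_apply]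
  exact sigmaR_map (ev y : smoothFun t →+* ℝ) k M.schMixed

theorem divMixed_newton_schouten_eq_zero (hn : 3 ≤ n) (k : ℕ) (hk : k < n) (r : Fin n) (y : t)
    (h0 : k ≤ 1 ∨ ∀ l t j, M.covAlt M.schMixed l t j = 0) :
    divMixed s G (fun z => newton k (schoutenMixed s G z)) r y = 0 := by
  rw [h.divMixed_apply y _ (newtonR M.schMixed k) (fun y => h.newton_apply k hk y),
    M.div_newtonR_schMixed_eq_zero hn k hk r h0, map_zero]

/-- The base metric `G` is here the flat one, and `Gu` is regarded as a conformal multiple of it. -/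
theorem divMixed_newton_schouten_eq_zero_of_flat (hn : 3 ≤ n) (k : ℕ) (hk : k < n) (r : Fin n)
    (y : t) (hflat : ∀ y ∈ t, ∀ i j l q, riem s G i j l q y = 0) {f : Euc n → ℝ}
    (hf : ContDiffOn ℝ ∞ f t) (hpos : ∀ z ∈ t, 0 < f z)
    (hGu : ∀ z ∈ t, ∀ i j, Gu z i j = f z * G z i j) :
    divMixed s Gu (fun z => newton k (schoutenMixed s Gu z)) r y = 0 := by
  have hw : smoothFun.of f hf * smoothFun.of (fun z => (f z)⁻¹)
      (hf.inv fun z hz => (hpos z hz).ne') = 1 := by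
    refine ext_ev fun z => ?_
    rw [map_mul, ev_of, ev_of, map_one, mul_inv_cancel₀ (hpos z z.2).ne']
  refine divMixed_newton_schouten_eq_zero (h.scale hw (fun z i j => hGu z z.2 i j)) hn k hk r y
    (Or.inr fun l t j => ?_)
  refine M.covAlt_schMixed_scale_eq_zero hw (D_eq_halfLogDeriv M hw) hn (fun i j => ?_) l t j
  ext1 l q
  refine ext_ev fun z => ?_
  rw [← h.riem_apply, hflat z z.2]
  exact (map_zero _).symm

theorem divMixed_newton_conformal (hn : 3 ≤ n) (k : ℕ) (hk : k < n) (r : Fin n) (y : Euc n)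
    (hy : y ∈ t) {v : Euc n → ℝ} (hv : ContDiffOn ℝ ∞ v t) (hpos : ∀ z ∈ t, 0 < v z)
    (hGu : ∀ z ∈ t, ∀ i j, Gu z i j = v z ^ (4 / ((n : ℝ) - 2)) * G z i j) :
    divMixed s G (fun z => newton k (schoutenMixed s Gu z)) r y =
      -(2 / ((n : ℝ) - 2)) * ∑ j, pd s j v y / v y *
          ((n : ℝ) * newton k (schoutenMixed s Gu y) j r
            - ((n : ℝ) - k) * sigma k (schoutenMixed s Gu y) * (if j = r then 1 else 0))
      + 1 / ((n : ℝ) - 2) * v y ^ (-(((n : ℝ) + 2) / ((n : ℝ) - 2))) *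
          ∑ q ∈ Finset.Ico 1 k, (-1) ^ (k - q) * ∑ j, ∑ l, ∑ t,
            newton q (schoutenMixed s Gu y) j l *
              (-2 * ∑ m, weyl s G j t l m y * gradUp s G v m y
                + v y * cottonUp s G l t j y) *
              (schoutenMixed s Gu y ^ (k - 1 - q)) t r := by
  have hn2 : (0 : ℝ) < (n : ℝ) - 2 := by
    have : (3 : ℝ) ≤ n := by exact_mod_cast hn
    linarith
  set p : ℝ := 4 / ((n : ℝ) - 2) with hp
  have hvp : ContDiffOn ℝ ∞ (fun z => v z ^ p) t :=
    hv.rpow_const_of_ne fun z hz => (hpos z hz).ne'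
  have hvm : ContDiffOn ℝ ∞ (fun z => v z ^ (-p)) t :=
    hv.rpow_const_of_ne fun z hz => (hpos z hz).ne'
  set w := smoothFun.of _ hvp
  set wi := smoothFun.of _ hvm
  have hw : w * wi = 1 := by
    refine ext_ev fun z => ?_
    rw [map_mul, ev_of, ev_of, map_one, ← Real.rpow_add (hpos z z.2), add_neg_cancel,
      Real.rpow_zero]
  have hφ := D_eq_halfLogDeriv M hw
  set φ := halfLogDeriv M w wi with hφdef
  have h' : Represents s Gu (M.scale w wi hw) := h.scale hw (fun z i j => hGu z z.2 i j)
  obtain ⟨Y, rfl⟩ : ∃ Y : t, (Y : Euc n) = y := ⟨⟨y, hy⟩, rfl⟩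
  have hvY : 0 < v Y := hpos Y hy
  -- Half the logarithmic derivative of `v^p` is `(p/2) dv/v`, and `p/2 = 2/(n-2)`. This also turns
  -- the factor `-(n-2)` of the Weyl term into `-2`.
  have hφY : ∀ i, ev Y (φ i) = 2 / ((n : ℝ) - 2) * (pd s i v Y / v Y) := by
    intro i
    have e1 : ev Y (M.D i w) = p * v Y ^ (p - 1) * pd s i v Y := by
      rw [← h.pd_apply i (fun z => v z ^ p) w (fun _ => rfl), h.pd_eq i _ Y Y.2,
        h.pd_eq i _ Y Y.2, pd_rpow h.uniqueDiffOn hv hy hvY]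
    have e2 : v Y ^ (-p) * v Y ^ (p - 1) = (v Y)⁻¹ := by
      rw [← Real.rpow_add hvY, ← Real.rpow_neg_one]; ring_nf
    rw [hφdef, halfLogDeriv, map_mul, map_mul, AlgHom.commutes, e1, ev_of,
      Algebra.algebraMap_self, RingHom.id_apply]
    calc 1 / 2 * v Y ^ (-p) * (p * v Y ^ (p - 1) * pd s i v Y)
        = (v Y ^ (-p) * v Y ^ (p - 1)) * (p / 2 * pd s i v Y) := by ring
      _ = _ := by rw [e2, hp]; field_simp; ring
  have hgrad : ∀ m, ev Y ((M.Gi *ᵥ φ) m) =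
      2 / ((n : ℝ) - 2) * (gradUp s G v m Y / v Y) := by
    intro m
    simp only [gradUp, Matrix.mulVec, dotProduct, map_sum, map_mul, hφY, ← h.inv_apply,
      Finset.sum_div, Finset.mul_sum]
    exact Finset.sum_congr rfl fun i _ => by ring
  -- The extra factor `v` clears the denominator of `∇v / v` in the Weyl term and becomes the
  -- coefficient of the Cotton term.
  have hpow : v Y ^ (-p) = v Y ^ (-(((n : ℝ) + 2) / ((n : ℝ) - 2))) * v Y := by
    nth_rewrite 3 [← Real.rpow_one (v Y)]
    rw [← Real.rpow_add hvY, hp]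
    congr 1
    field_simp; ring
  set A := (M.scale w wi hw).schMixed with hA
  have hAY : schoutenMixed s Gu Y = A.map (ev Y) := h'.schoutenMixed_apply Y
  have main := congrArg (ev Y) (M.div_newtonR_schMixed_scale hw hφ hn k hk r A hA)
  rw [← h.divMixed_apply Y (fun z => newton k (schoutenMixed s Gu z)) (newtonR A k)
    (fun y => h'.newton_apply k hk y)] at main
  rw [main]
  have hApow : ∀ (e : ℕ) (a b : Fin n), (schoutenMixed s Gu Y ^ e) a b = ev Y ((A ^ e) a b) := by
    intro e a b
    have := congrFun (congrFun (map_pow (AlgHom.mapMatrix (m := Fin n) (ev Y)) A e) a) b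
    rw [hAY]
    exact this.symm
  rw [map_add, map_neg, map_sum, map_mul, map_mul, map_sum]
  congr 1
  · rw [neg_mul, Finset.mul_sum]
    congr 1
    refine Finset.sum_congr rfl fun j _ => ?_
    simp only [map_mul, map_sub, map_natCast, hφY, h'.newton_apply k hk Y, h'.sigma_apply,
      Matrix.map_apply, Matrix.one_apply, apply_ite (ev Y), map_one, map_zero]
    rw [mul_assoc]
  · rw [AlgHom.commutes, Algebra.algebraMap_self, RingHom.id_apply, ev_of, hpow]
    rw [mul_assoc, mul_assoc, mul_assoc]
    congr 2
    rw [Finset.mul_sum]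
    refine Finset.sum_congr rfl fun q hq => ?_
    have hqn : q < n := lt_trans (Finset.mem_Ico.mp hq).2 hk
    rw [map_mul, map_pow, map_neg, map_one, mul_left_comm]
    congr 1
    rw [map_sum, Finset.mul_sum]
    refine Finset.sum_congr rfl fun j _ => ?_
    rw [map_sum, Finset.mul_sum]
    refine Finset.sum_congr rfl fun l _ => ?_
    rw [map_sum, Finset.mul_sum]
    refine Finset.sum_congr rfl fun t _ => ?_
    simp only [map_mul, map_add, map_neg, map_sub, map_sum, map_natCast, map_ofNat, hgrad,
      h'.newton_apply q hqn Y, Matrix.map_apply, hApow, ← h.weyl_apply, ← h.cottonUp_apply]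
    have hsum : ∑ m, weyl s G j t l m Y * (2 / ((n : ℝ) - 2) * (gradUp s G v m Y / v Y)) =
        2 / ((n : ℝ) - 2) / v Y * ∑ m, weyl s G j t l m Y * gradUp s G v m Y := by
      rw [Finset.mul_sum]
      exact Finset.sum_congr rfl fun m _ => by ring
    rw [hsum, ← hA]
    field_simp

end Conformal

end ConfGeom

/-! ### Charts: coordinate domains and metric components -/

namespace ConfGeom

open Matrix

variable {n : ℕ} {H : Type*} [TopologicalSpace H] {I : ModelWithCorners ℝ (Euc n) H}
  {M : Type*} [TopologicalSpace M]

section Chart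

variable (e : OpenPartialHomeomorph M H)

theorem uniqueDiffOn_extend_target : UniqueDiffOn ℝ (e.extend I).target := by
  rw [e.extend_target]
  exact I.uniqueDiffOn_preimage e.open_target

/-- The set is relatively open in the range of `I`, which lies in the closure of its own interior.
Needed for `pd_comm` at the boundary. -/
theorem extend_target_inter_subset_closure_interior {O : Set (Euc n)} (hO : IsOpen O) :
    (e.extend I).target ∩ O ⊆ closure (interior ((e.extend I).target ∩ O)) := by
  have hU : IsOpen (I.symm ⁻¹' e.target ∩ O) := (e.open_target.preimage I.continuous_symm).inter hO
  have h1 : (e.extend I).target ∩ O = (I.symm ⁻¹' e.target ∩ O) ∩ Set.range I := by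
    rw [e.extend_target, Set.inter_right_comm]
  rw [h1, interior_inter, hU.interior_eq]
  intro y hy
  exact hU.inter_closure ⟨hy.1, I.range_subset_closure_interior hy.2⟩

variable {e} [ChartedSpace H M] (he : e ∈ IsManifold.maximalAtlas I ∞ M)
include he

theorem contMDiffOn_extend_symm_target :
    ContMDiffOn 𝓘(ℝ, Euc n) I ∞ (e.extend I).symm (e.extend I).target := by
  rw [e.extend_target']
  exact contMDiffOn_extend_symm he

theorem contDiffOn_comp_extend_symm {f : M → ℝ} {V : Set M} (hf : ContMDiffOn I 𝓘(ℝ) ∞ f V) :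
    ContDiffOn ℝ ∞ (fun z => f ((e.extend I).symm z))
      ((e.extend I).target ∩ (e.extend I).symm ⁻¹' V) :=
  (hf.comp ((contMDiffOn_extend_symm_target he).mono Set.inter_subset_left)
    (fun _ hz => hz.2)).contDiffOn

theorem mfderivWithin_extend_symm_injective {y : Euc n} (hy : y ∈ (e.extend I).target) :
    Function.Injective
      (mfderivWithin 𝓘(ℝ, Euc n) I (e.extend I).symm (e.extend I).target y) := by
  have hx : (e.extend I).symm y ∈ e.source := by
    rw [← e.extend_source (I := I)]; exact (e.extend I).map_target hy
  have hu : UniqueMDiffWithinAt 𝓘(ℝ, Euc n) (e.extend I).target y :=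
    (uniqueDiffOn_extend_target e).uniqueMDiffOn y hy
  have h1 := mfderivWithin_comp (u := Set.univ) y
    (((e.contMDiffAt_extend he hx).mdifferentiableAt (by simp)).mdifferentiableWithinAt)
    (((contMDiffOn_extend_symm_target he) y hy).mdifferentiableWithinAt (by simp))
    (Set.subset_univ _) hu
  have h2 : mfderivWithin 𝓘(ℝ, Euc n) 𝓘(ℝ, Euc n) (e.extend I ∘ (e.extend I).symm)
      (e.extend I).target y = ContinuousLinearMap.id ℝ (Euc n) := by
    have h3 : mfderivWithin 𝓘(ℝ, Euc n) 𝓘(ℝ, Euc n) (e.extend I ∘ (e.extend I).symm)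
      (e.extend I).target y = mfderivWithin 𝓘(ℝ, Euc n) 𝓘(ℝ, Euc n) id (e.extend I).target y :=
      mfderivWithin_congr (fun z hz => (e.extend I).right_inv hz) ((e.extend I).right_inv hy)
    rw [h3, mfderivWithin_id hu]
    rfl
  intro a b hab
  have h4 := congrArg (mfderivWithin I 𝓘(ℝ, Euc n) (e.extend I) Set.univ
    ((e.extend I).symm y)) hab
  have h5 : ∀ c : Euc n, (mfderivWithin I 𝓘(ℝ, Euc n) (e.extend I) Set.univ
    ((e.extend I).symm y)) (mfderivWithin 𝓘(ℝ, Euc n) I (e.extend I).symm (e.extend I).target y c)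
      = c := by
    intro c
    have h6 : (mfderivWithin 𝓘(ℝ, Euc n) 𝓘(ℝ, Euc n) (e.extend I ∘ (e.extend I).symm)
      (e.extend I).target y) c = c := by rw [h2]; rfl
    rw [h1] at h6
    exact h6
  rw [← h5 a, ← h5 b]
  exact h4

variable [IsManifold I ∞ M]

theorem contMDiffOn_coordVec (i : Fin n) :
    ContMDiffOn 𝓘(ℝ, Euc n) I.tangent ∞
      (fun y => (Bundle.TotalSpace.mk' (Euc n) ((e.extend I).symm y) (coordVec I e i y) :
        TangentBundle I M)) (e.extend I).target := by
  have : IsManifold I 1 M := IsManifold.of_le (n := ∞) (by exact_mod_cast le_top)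
  have h1 := (contMDiffOn_extend_symm_target he).contMDiffOn_tangentMapWithin (m := ∞) le_rfl
    (uniqueDiffOn_extend_target e).uniqueMDiffOn
  have h2 : ContMDiffOn 𝓘(ℝ, Euc n) 𝓘(ℝ, Euc n).tangent ∞
      (fun y => (Bundle.TotalSpace.mk' (Euc n) y (EuclideanSpace.single i 1 : Euc n) :
        TangentBundle 𝓘(ℝ, Euc n) (Euc n))) (e.extend I).target :=
    contMDiffOn_vectorSpace_iff_contDiffOn.2 contDiffOn_const
  exact h1.comp h2 fun y hy => hy

theorem contDiffOn_components (g : Bundle.ContMDiffRiemannianMetric I ∞ (Euc n)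
    (fun x : M => TangentSpace I x)) (i j : Fin n) :
    ContDiffOn ℝ ∞ (fun z => components g.inner e z i j) (e.extend I).target := by
  rw [← contMDiffOn_iff_contDiffOn]
  have hψ := g.contMDiff.comp_contMDiffOn (contMDiffOn_extend_symm_target he)
  intro y hy
  have h := ContMDiffWithinAt.clm_bundle_apply₂ (F₁ := Euc n) (F₂ := Euc n) (F₃ := ℝ)
    (E₃ := Bundle.Trivial M ℝ) (hψ y hy)
    (contMDiffOn_coordVec he i y hy) (contMDiffOn_coordVec he j y hy)
  simp only [Bundle.contMDiffWithinAt_totalSpace] at h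
  exact h.2

/-- A kernel vector of the Gram matrix would give a combination of the coordinate fields that is
nonzero, by injectivity of the differential, yet has zero length. -/
theorem det_components_ne_zero (g : Bundle.ContMDiffRiemannianMetric I ∞ (Euc n)
    (fun x : M => TangentSpace I x)) {y : Euc n} (hy : y ∈ (e.extend I).target) :
    (components g.inner e y).det ≠ 0 := by
  intro hdet
  obtain ⟨c, hc, hGc⟩ := Matrix.exists_mulVec_eq_zero_iff.2 hdet
  let L : Euc n →L[ℝ] TangentSpace I ((e.extend I).symm y) :=
    mfderivWithin 𝓘(ℝ, Euc n) I (e.extend I).symm (e.extend I).target y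
  let C : Euc n := ∑ i, c i • EuclideanSpace.single i (1 : ℝ)
  have hC : C ≠ 0 := by
    intro h0
    apply hc
    funext i
    have := congrArg (fun v : Euc n => v i) h0
    simpa [C, Pi.single_apply] using this
  have hLC : L C ≠ 0 := by
    intro h0
    exact hC (mfderivWithin_extend_symm_injective he hy (h0.trans (map_zero L).symm))
  have hpos := g.pos _ (L C) hLC
  have hsum : L C = ∑ i, c i • coordVec I e i y := by
    change L (∑ i, c i • EuclideanSpace.single i (1 : ℝ)) = _
    rw [map_sum]
    exact Finset.sum_congr rfl fun i _ => L.map_smul _ _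
  have h0 : g.inner _ (L C) (L C) = c ⬝ᵥ (components g.inner e y *ᵥ c) := by
    rw [hsum]
    simp only [map_sum, map_smul, _root_.sum_apply, _root_.smul_apply,
      dotProduct, mulVec, components, Matrix.of_apply, Finset.mul_sum, smul_eq_mul]
    rw [Finset.sum_comm]
    exact Finset.sum_congr rfl fun i _ => Finset.sum_congr rfl fun j _ => by ring
  rw [h0, hGc, dotProduct_zero] at hpos
  exact lt_irrefl _ hpos

end Chart

end ConfGeom

/-! ### Metric algebras attached to Riemannian metrics on a manifold -/

namespace ConfGeom

open Matrix smoothFun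

section Manifold

variable {n : ℕ} {H : Type*} [TopologicalSpace H] {I : ModelWithCorners ℝ (Euc n) H}
  {M : Type*} [TopologicalSpace M] [ChartedSpace H M]

variable [IsManifold I ∞ M]

theorem exists_represents_components (g : Bundle.ContMDiffRiemannianMetric I ∞ (Euc n)
    (fun x : M => TangentSpace I x)) {e : OpenPartialHomeomorph M H}
    (he : e ∈ IsManifold.maximalAtlas I ∞ M) {O : Set (Euc n)} (hO : IsOpen O) :
    ∃ A : MetricAlgebra n (smoothFun ((e.extend I).target ∩ O)),
      Represents (e.extend I).target (components g.inner e) A :=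
  ⟨_, represents_coordAlgebra hO ((uniqueDiffOn_extend_target e).inter hO)
    (extend_target_inter_subset_closure_interior e hO) _
    (fun i j => (contDiffOn_components he g i j).mono Set.inter_subset_left)
    (fun _ _ => by ext i j; exact g.symm _ _ _)
    (fun _ hz => det_components_ne_zero he g hz.1)⟩

/-- The components of a metric `ρ g`, where `ρ` is smooth and positive in a part of the coordinate
domain. -/
theorem exists_represents_components_rescale (g : Bundle.ContMDiffRiemannianMetric I ∞ (Euc n)
    (fun x : M => TangentSpace I x)) {e : OpenPartialHomeomorph M H}
    (he : e ∈ IsManifold.maximalAtlas I ∞ M) {O : Set (Euc n)} (hO : IsOpen O) {ρ : M → ℝ}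
    (hρ : ContDiffOn ℝ ∞ (fun z => ρ ((e.extend I).symm z)) ((e.extend I).target ∩ O))
    (hpos : ∀ z ∈ (e.extend I).target ∩ O, 0 < ρ ((e.extend I).symm z)) :
    ∃ A : MetricAlgebra n (smoothFun ((e.extend I).target ∩ O)),
      Represents (e.extend I).target (components (rescale ρ g.inner) e) A := by
  obtain ⟨A, hA⟩ := exists_represents_components g he hO
  have hw : smoothFun.of _ hρ * smoothFun.of _ (hρ.inv fun z hz => (hpos z hz).ne') = 1 := by
    refine ext_ev fun z => ?_
    rw [map_mul, ev_of, ev_of, map_one]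
    exact mul_inv_cancel₀ (hpos z z.2).ne'
  exact ⟨_, hA.scale hw fun _ _ _ => rfl⟩

end Manifold

end ConfGeom

open ConfGeom

theorem mainTheorem10 {n : ℕ} (hn : 3 ≤ n)
    {H : Type*} [TopologicalSpace H] (I : ModelWithCorners ℝ (ConfGeom.Euc n) H)
    {U : Type*} [TopologicalSpace U] [ChartedSpace H U] [IsManifold I ∞ U]
    (g : Bundle.ContMDiffRiemannianMetric I ∞ (ConfGeom.Euc n)
      (fun x : U => TangentSpace I x))
    (u : U → ℝ) (hu : ContMDiff I 𝓘(ℝ) ∞ u) (hu_pos : ∀ x, 0 < u x)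
    (k : ℕ) (hk : k < n) :
    -- the divergence identity, in every coordinate system of `U`
    (∀ e ∈ IsManifold.maximalAtlas I ∞ U, ∀ x ∈ e.source, ∀ r : Fin n,
      let s : Set (ConfGeom.Euc n) := (e.extend I).target
      let y : ConfGeom.Euc n := e.extend I x
      -- the components of `g`, of `u` and of the `(1,1)`-Schouten tensor of `g_u`
      let G := ConfGeom.components g.inner e
      let v : ConfGeom.Euc n → ℝ := fun z => u ((e.extend I).symm z)
      let A := ConfGeom.schoutenMixed s (ConfGeom.components (ConfGeom.conformal u g.inner) e)
      ConfGeom.divMixed s G (fun z => ConfGeom.newton k (A z)) r y =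
        -(2 / ((n : ℝ) - 2)) * ∑ j, ConfGeom.pd s j v y / u x *
            ((n : ℝ) * ConfGeom.newton k (A y) j r
              - ((n : ℝ) - k) * ConfGeom.sigma k (A y) * (if j = r then 1 else 0))
        + 1 / ((n : ℝ) - 2) * u x ^ (-(((n : ℝ) + 2) / ((n : ℝ) - 2))) *
            ∑ q ∈ Finset.Ico 1 k, (-1) ^ (k - q) * ∑ j, ∑ l, ∑ t,
              ConfGeom.newton q (A y) j l *
                (-2 * ∑ m, ConfGeom.weyl s G j t l m y * ConfGeom.gradUp s G v m y
                  + u x * ConfGeom.cottonUp s G l t j y) *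
                (A y ^ (k - 1 - q)) t r) ∧
    -- the divergence-free property with respect to `g_u`
    (ConfGeom.LocallyConformallyFlat g.inner ∨ k ≤ 1 →
      ∀ e ∈ IsManifold.maximalAtlas I ∞ U, ∀ x ∈ e.source, ∀ r : Fin n,
        let s : Set (ConfGeom.Euc n) := (e.extend I).target
        let Gu := ConfGeom.components (ConfGeom.conformal u g.inner) e
        ConfGeom.divMixed s Gu
          (fun z => ConfGeom.newton k (ConfGeom.schoutenMixed s Gu z)) r (e.extend I x) = 0) := by
  have hv : ∀ e ∈ IsManifold.maximalAtlas I ∞ U,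
      ContDiffOn ℝ ∞ (fun z => u ((e.extend I).symm z)) (e.extend I).target := fun e he =>
    (contDiffOn_comp_extend_symm he (hu.contMDiffOn (s := Set.univ))).mono fun z hz =>
      ⟨hz, Set.mem_univ _⟩
  have hmem : ∀ (e : OpenPartialHomeomorph U H), ∀ x ∈ e.source,
      e.extend I x ∈ (e.extend I).target := fun e x hx =>
    (e.extend I).map_source (by rwa [e.extend_source])
  refine ⟨fun e he x hx r => ?_, fun hcase e he x hx r => ?_⟩
  · intro s y G v A
    obtain ⟨A, hA⟩ := exists_represents_components g he isOpen_univ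
    have hvy : v y = u x := by
      change u ((e.extend I).symm (e.extend I x)) = u x
      rw [e.extend_left_inv hx]
    have h := divMixed_newton_conformal hA hn k hk r y ⟨hmem e x hx, Set.mem_univ _⟩ (v := v)
      ((hv e he).mono Set.inter_subset_left) (fun z _ => hu_pos _)
      (Gu := components (conformal u g.inner) e) (fun z _ i j => rfl)
    rw [hvy] at h
    exact h
  · intro s Gu
    have hvp : ContDiffOn ℝ ∞ (fun z => u ((e.extend I).symm z) ^ (4 / ((n : ℝ) - 2)))
        (e.extend I).target := (hv e he).rpow_const_of_ne fun z _ => (hu_pos _).ne'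
    rcases hcase with hflat | hk1
    · obtain ⟨V, hV, hxV, ρ, hρ, hρpos, hR⟩ := hflat x
      -- The coordinate image of `V`, written as an open subset of the model space; the flat
      -- multiple of `g` is available only there.
      set O : Set (Euc n) := I.symm ⁻¹' (e.target ∩ e.symm ⁻¹' V) with hOdef
      have hO : IsOpen O := (e.isOpen_inter_preimage_symm hV).preimage I.continuous_symm
      have hOV : ∀ z ∈ s ∩ O, (e.extend I).symm z ∈ V := fun z hz => hz.2.2
      have hρ' : ContDiffOn ℝ ∞ (fun z => ρ ((e.extend I).symm z)) (s ∩ O) :=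
        (contDiffOn_comp_extend_symm he hρ).mono fun z hz => ⟨hz.1, hOV z hz⟩
      have hpos : ∀ z ∈ s ∩ O, 0 < ρ ((e.extend I).symm z) := fun z hz => hρpos _ (hOV z hz)
      obtain ⟨A, hA⟩ := exists_represents_components_rescale g he hO hρ' hpos
      have hxO : e.extend I x ∈ s ∩ O := by
        refine ⟨hmem e x hx, ?_⟩
        simp only [hOdef, Set.mem_preimage, e.extend_coe, Function.comp_apply, I.left_inv]
        exact ⟨e.map_source hx, by rwa [Set.mem_preimage, e.left_inv hx]⟩
      -- With the flat metric `ρ g` as base, `g_u` has conformal factor `u^(4/(n-2)) ρ⁻¹`.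
      refine divMixed_newton_schouten_eq_zero_of_flat hA hn k hk r ⟨_, hxO⟩ ?_
        ((hvp.mono Set.inter_subset_left).mul (hρ'.inv fun z hz => (hpos z hz).ne'))
        (fun z hz => mul_pos (Real.rpow_pos_of_pos (hu_pos _) _) (inv_pos.2 (hpos z hz)))
        (fun z hz i j => ?_)
      · intro z hz i j l q
        have hzs : (e.extend I).symm z ∈ e.source := by
          rw [← e.extend_source (I := I)]; exact (e.extend I).map_target hz.1
        have h := hR e he _ ⟨hzs, hOV z hz⟩ i j l q
        rwa [(e.extend I).right_inv hz.1] at h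
      · change u ((e.extend I).symm z) ^ (4 / ((n : ℝ) - 2)) * components g.inner e z i j =
          u ((e.extend I).symm z) ^ (4 / ((n : ℝ) - 2)) * (ρ ((e.extend I).symm z))⁻¹ *
            (ρ ((e.extend I).symm z) * components g.inner e z i j)
        have := (hpos z hz).ne'
        field_simp
    -- For `k ≤ 1` no comparison of metrics is needed: the algebra of `g_u` itself is used, and the
    -- sum over `q` is empty.
    · obtain ⟨A, hA⟩ := exists_represents_components_rescale g he isOpen_univ
        (ρ := fun x => u x ^ (4 / ((n : ℝ) - 2))) (hvp.mono Set.inter_subset_left) (fun z _ => Real.rpow_pos_of_pos (hu_pos _) _)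
      exact divMixed_newton_schouten_eq_zero hA hn k hk r ⟨_, hmem e x hx, Set.mem_univ _⟩
        (Or.inl hk1)
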